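/- Let $k$ be a field and let $F$ be a finitely generated field extension of $k$. Let $v$ be a monomial valuation on $F$ over $k$. That is, $v$ is a valuation on $F$, trivial on $k$, of rank one (nontrivial, with value group embeddable as an ordered group in $\mathbb{R}$), whose rational rank $\dim_{\mathbb{Q}}(v(F^\times)\otimes_{\mathbb{Z}}\mathbb{Q})$ equals the transcendence degree of $F$ over $k$, and whose residue field is $k$ (the canonical map from $k$ to the residue field is an isomorphism). Regard $v$ as written additively with values in $\mathbb{R}\cup\{+\infty\}$, through any embedding of its value group into $\mathbb{R}$. Let $x_1,\dots,x_n\in F$ be such that $v(x_1),\dots,v(x_n)$ form a $\mathbb{Z}$-basis of the value group $v(F^\times)$. For $I=(I_1,\dots,I_n)\in\mathbb{Z}^n$ write $x^I=x_1^{I_1}\cdots x_n^{I_n}$. Let $\widehat F$ be the completion of $F$ under $v$, and let $k((x_1,\dots,x_n))_v$ be the completion of the subfield $k(x_1,\dots,x_n)\subseteq F$ under the restriction of $v$. Then: 1. There is an isomorphism of topological fields $k((x_1,\dots,x_n))_v\cong\widehat F$ which extends the inclusion $k(x_1,\dots,x_n)\subseteq F$ and preserves the extended valuations. 2. Consider the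 ring of formal sums $\sum_{I\in\mathbb{Z}^n}a_Ix^I$ with $a_I\in k$ such that for any $c\in\mathbb{R}$ there are only finitely many $I$ with $v(x^I)<c$ and $a_I\neq0$. Addition is coefficientwise and the product is $(ab)_I=\sum_{J+K=I}a_Jb_K$. There is a ring isomorphism from it onto the field $k((x_1,\dots,x_n))_v$ which sends each formal sum to the sum of the (unconditionally convergent) series $\sum_I a_Ix^I$ in $k((x_1,\dots,x_n))_v$. The valuation of the image of a nonzero formal sum is the minimum of the $v(x^I)$ with $a_I\neq0$. -/

import Mathlib

open scoped NNReal

noncomputable section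

namespace MonomialValuation

universe uk uF uΓ

/-! ### Monomial valuations -/

section Valuations

variable {k : Type uk} {F : Type uF} [Field k] [Field F] [Algebra k F]
variable {Γ₀ : Type uΓ} [LinearOrderedCommGroupWithZero Γ₀]

/-- The value group of `v`, i.e. `v(Fˣ)`, written additively. -/
abbrev ValueGroup (v : Valuation F Γ₀) : Type uΓ :=
  Additive (MonoidWithZeroHom.valueGroup (.ofClass v : F →*₀ Γ₀))

/-- The rational rank of `v`: the rank of the abelian group `v(Fˣ)`, that is, the supremum of
the cardinalities of its `ℤ`-linearly independent families. -/
abbrev ratrank (v : Valuation F Γ₀) : Cardinal.{uΓ} := Module.rank ℤ (ValueGroup v)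

/-- If `v` is trivial on `k`, then `k` is contained in the valuation ring of `v`; this is the
inclusion. -/
def coeffToValuationRing (v : Valuation F Γ₀) (hv : v.IsTrivialOn k) :
    k →+* v.valuationSubring :=
  (algebraMap k F).codRestrict v.valuationSubring fun c => by
    rw [Valuation.mem_valuationSubring_iff]
    by_cases hc : c = 0
    · simp [hc]
    · exact (hv.eq_one c hc).le

/-- The canonical map from `k` to the residue field `κ_v` of a valuation over `k`. -/
def coeffToResidueField (v : Valuation F Γ₀) (hv : v.IsTrivialOn k) :
    k →+* IsLocalRing.ResidueField v.valuationSubring :=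
  (IsLocalRing.residue v.valuationSubring).comp (coeffToValuationRing v hv)

variable (k) in
/-- A valuation `v` on `F` over `k` is *monomial* if `rank(v) = 1`,
`ratrank(v) = trdeg(F/k)` and `κ_v = k`. -/
structure IsMonomial (v : Valuation F Γ₀) : Prop where
  /-- `v` is a valuation over `k`. -/
  isTrivialOn : v.IsTrivialOn k
  /-- `v` has rank one: it is nontrivial and its value group embeds, as an ordered group, into that of
  the positive reals (equivalently, into `ℝ` written additively). -/
  rank_eq_one : Nonempty v.RankOne
  /-- The rational rank of `v` is the transcendence degree of `F` over `k`. -/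
  ratrank_eq_trdeg :
    Cardinal.lift.{uF} (ratrank v) = Cardinal.lift.{uΓ} (Algebra.trdeg k F)
  /-- The residue field of `v` is `k`. -/
  residueField_eq : Function.Bijective (coeffToResidueField v isTrivialOn)

/-- `v(x₁), …, v(xₙ)` freely generate the value group of `v`, i.e. form a `ℤ`-basis of it
(in particular the `xᵢ` are nonzero). -/
def FreelyGenerate (v : Valuation F Γ₀) {n : ℕ} (x : Fin n → F) : Prop :=
  ∃ b : Module.Basis (Fin n) ℤ (ValueGroup v), ∀ i, (((b i).toMul : Γ₀ˣ) : Γ₀) = v (x i)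

/-- A rank one valuation in additive notation, with values in `ℝ`: `y ↦ -log |y|_v`, where
`|·|_v` is `v` followed by the chosen embedding of the value group into the positive reals.
Only used for nonzero `y`. -/
def realValue (v : Valuation F Γ₀) [v.RankOne] (y : F) : ℝ :=
  -Real.log (Valuation.RankOne.hom v (v.restrict y) : ℝ≥0)

/-- The subfield `k(x₁, …, xₙ)` of `F`. -/
abbrev generatedField (k : Type uk) {F : Type uF} [Field k] [Field F] [Algebra k F]
    {n : ℕ} (x : Fin n → F) : IntermediateField k F :=
  IntermediateField.adjoin k (Set.range x)

/-- The restriction of `v` to `k(x₁, …, xₙ)`. -/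
abbrev restrictToGenerated (k : Type uk) {F : Type uF} [Field k] [Field F] [Algebra k F]
    (v : Valuation F Γ₀) {n : ℕ} (x : Fin n → F) : Valuation (generatedField k x) Γ₀ :=
  v.comap (algebraMap (generatedField k x) F)

/-- The monomial `x^I = x₁^{I₁} ⋯ xₙ^{Iₙ}`, for `I ∈ ℤⁿ`, as an element of `k(x₁, …, xₙ)`. -/
def monomial (k : Type uk) {F : Type uF} [Field k] [Field F] [Algebra k F]
    {n : ℕ} (x : Fin n → F) (I : Fin n → ℤ) : generatedField k x :=
  ∏ i, (⟨x i, IntermediateField.subset_adjoin k _ ⟨i, rfl⟩⟩ : generatedField k x) ^ I i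

/-- The canonical map from a field to its completion with respect to a valuation. -/
def toCompletion (v : Valuation F Γ₀) (y : F) : v.Completion :=
  ((WithVal.toVal v y : WithVal v) : v.Completion)

end Valuations

/-! ### Formal sums -/

section FormalSums

variable {n : ℕ}

/-- The group `ℤⁿ` of exponents. The real weights `w` of the variables are recorded in order to
put on it the partial order in which `I < J` when the weight of `I` is less than that of `J`. -/
def Exponent (_w : Fin n → ℝ) : Type := Fin n → ℤ

instance (w : Fin n → ℝ) : AddCommGroup (Exponent w) :=
  inferInstanceAs (AddCommGroup (Fin n → ℤ))

/-- The weight `I₁ w₁ + ⋯ + Iₙ wₙ` of the exponent `I`: if `wᵢ = v(xᵢ)`, this is `v(x^I)`. -/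
def weight (w : Fin n → ℝ) : Exponent w →+ ℝ where
  toFun I := ∑ i, ((show Fin n → ℤ from I) i : ℝ) * w i
  map_zero' := Finset.sum_eq_zero fun i _ => by
    change (((0 : ℤ) : ℝ)) * w i = 0
    simp
  map_add' I J := by
    rw [← Finset.sum_add_distrib]
    refine Finset.sum_congr rfl fun i _ => ?_
    change (((I i + J i : ℤ) : ℝ)) * w i = _
    rw [Int.cast_add, add_mul]

instance (w : Fin n → ℝ) : PartialOrder (Exponent w) where
  le I J := I = J ∨ weight w I < weight w J
  le_refl I := Or.inl rfl
  le_trans I J K := by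
    rintro (rfl | h) (rfl | h')
    · exact Or.inl rfl
    · exact Or.inr h'
    · exact Or.inr h
    · exact Or.inr (h.trans h')
  le_antisymm I J := by
    rintro (rfl | h) (h' | h')
    · rfl
    · rfl
    · exact h'.symm
    · exact absurd h' h.asymm

instance (w : Fin n → ℝ) : IsOrderedCancelAddMonoid (Exponent w) where
  add_le_add_left I J h K := by
    rcases h with rfl | h
    · exact Or.inl rfl
    · exact Or.inr (by simpa using h)
  le_of_add_le_add_left I J K h := by
    rcases h with h | h
    · exact Or.inl (add_left_cancel h)
    · exact Or.inr (by simpa using h)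

/-- A set of exponents is *finite below every bound* if for every `c ∈ ℝ` only finitely many of
its elements have weight less than `c`. -/
def FiniteBelow {w : Fin n → ℝ} (S : Set (Exponent w)) : Prop :=
  ∀ c : ℝ, {I | I ∈ S ∧ weight w I < c}.Finite

lemma FiniteBelow.mono {w : Fin n → ℝ} {S T : Set (Exponent w)} (hT : FiniteBelow T)
    (h : S ⊆ T) : FiniteBelow S :=
  fun c => (hT c).subset fun _ hI => ⟨h hI.1, hI.2⟩

lemma FiniteBelow.union {w : Fin n → ℝ} {S T : Set (Exponent w)} (hS : FiniteBelow S)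
    (hT : FiniteBelow T) : FiniteBelow (S ∪ T) := fun c => by
  refine ((hS c).union (hT c)).subset ?_
  rintro I ⟨h | h, hc⟩
  · exact Or.inl ⟨h, hc⟩
  · exact Or.inr ⟨h, hc⟩

lemma FiniteBelow.exists_lower {w : Fin n → ℝ} {S : Set (Exponent w)} (hS : FiniteBelow S) :
    ∃ m : ℝ, ∀ I ∈ S, m ≤ weight w I := by
  obtain ⟨m, hm⟩ := ((hS 0).image (weight w)).bddBelow
  refine ⟨min m 0, fun I hI => ?_⟩
  by_cases h : weight w I < 0
  · exact (min_le_left _ _).trans (hm ⟨I, ⟨hI, h⟩, rfl⟩)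
  · exact (min_le_right _ _).trans (not_lt.1 h)

lemma FiniteBelow.add {w : Fin n → ℝ} {S T : Set (Exponent w)} (hS : FiniteBelow S)
    (hT : FiniteBelow T) : FiniteBelow {K | ∃ I ∈ S, ∃ J ∈ T, I + J = K} := fun c => by
  obtain ⟨m, hm⟩ := hS.exists_lower
  obtain ⟨m', hm'⟩ := hT.exists_lower
  refine (((hS (c - m')).prod (hT (c - m))).image fun p => p.1 + p.2).subset ?_
  rintro K ⟨⟨I, hI, J, hJ, rfl⟩, hc⟩
  rw [map_add] at hc
  have h1 := hm I hI
  have h2 := hm' J hJ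
  exact ⟨(I, J), ⟨⟨hI, by linarith⟩, ⟨hJ, by linarith⟩⟩, rfl⟩

lemma FiniteBelow.isPWO {w : Fin n → ℝ} {S : Set (Exponent w)} (hS : FiniteBelow S) :
    S.IsPWO := by
  unfold Set.IsPWO
  rw [Set.partiallyWellOrderedOn_iff_exists_lt]
  intro f hf
  by_cases h : ∃ j, weight w (f 0) < weight w (f j)
  · obtain ⟨j, hj⟩ := h
    have hj0 : 0 < j := by
      rcases Nat.eq_zero_or_pos j with rfl | h
      · exact absurd hj (lt_irrefl _)
      · exact h
    exact ⟨0, j, hj0, Or.inr hj⟩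
  · simp only [not_exists, not_lt] at h
    have hmap : Set.MapsTo f Set.univ {I | I ∈ S ∧ weight w I < weight w (f 0) + 1} :=
      fun j _ => ⟨hf j, (h j).trans_lt (lt_add_one _)⟩
    obtain ⟨i, -, j, -, hij, he⟩ :=
      Set.infinite_univ.exists_lt_map_eq_of_mapsTo hmap (hS _)
    exact ⟨i, j, hij, Or.inl he⟩

/-- The ring of formal sums `∑ a_I x^I` with `I ∈ ℤⁿ` and `a_I ∈ k` such that for any `c ∈ ℝ`
there are only finitely many `I` of weight less than `c` with `a_I ≠ 0`. Sums and products are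
those of Hahn series, i.e. `(a + b)_I = a_I + b_I` and `(a b)_I = ∑_{J + K = I} a_J b_K`. -/
def formalSumsSubalgebra (k : Type uk) [Field k] (w : Fin n → ℝ) :
    Subalgebra k (HahnSeries (Exponent w) k) where
  carrier := {a | FiniteBelow a.support}
  mul_mem' {a b} ha hb := (ha.add hb).mono fun K hK => by
    obtain ⟨I, hI, J, hJ, h⟩ := HahnSeries.support_mul_subset hK
    exact ⟨I, hI, J, hJ, h⟩
  add_mem' {a b} ha hb := (ha.union hb).mono (HahnSeries.support_add_subset a b)
  algebraMap_mem' r c := by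
    refine (Set.finite_singleton (0 : Exponent w)).subset ?_
    rintro I ⟨hI, -⟩
    exact HahnSeries.support_single_subset hI

/-- The `k`-algebra of formal sums, as a type. -/
abbrev FormalSums (k : Type uk) [Field k] (w : Fin n → ℝ) : Type uk :=
  formalSumsSubalgebra k w

/-- The formal sum with a given family of coefficients. -/
def FormalSums.mk {k : Type uk} [Field k] {w : Fin n → ℝ} (a : Exponent w → k)
    (ha : FiniteBelow (Function.support a)) : FormalSums k w :=
  ⟨⟨a, ha.isPWO⟩, ha⟩

/-- The coefficient `a_I` of a formal sum. -/
def FormalSums.coeff {k : Type uk} [Field k] {w : Fin n → ℝ} (a : FormalSums k w)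
    (I : Fin n → ℤ) : k :=
  a.1.coeff I

end FormalSums

end MonomialValuation

end

/-!
Write the valuation additively, with values in `ℝ ∪ {∞}`. As the values of `x₁, …, xₙ` are a basis
of the value group and the residue field is `k`, different monomials `x^I` have different values,
and every nonzero `y ∈ F` has a leading term: a term `a x^I` with `v (y - a x^I) > v y`. These facts
make up `IsMonomialSystem`.

The heart of the matter is that every `y ∈ F` is a limit of Laurent polynomials in the `xᵢ`
(`IsMonomialSystem.isApprox_of_isAlgebraic`). Subtracting leading terms again and again gives an
expansion of `y`, but a priori the values of its terms may be bounded. Now the `xᵢ` are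
algebraically independent, and their number is the transcendence degree, so that `y` is algebraic
over `k(x₁, …, xₙ)`. This is used in two ways.

* In characteristic zero, let `C` be the closure of the ring of Laurent polynomials, a field which
  contains `k(x₁, …, xₙ)`. If `y ∉ C`, then the values `v (y - z)` with `z ∈ C` have a finite
  supremum, and it is not attained, since every approximation can be improved by a leading term.
  But one step of Newton's method, applied to a derivative of a polynomial with the root `y`, yields
  an approximation at least as good as the supremum (`exists_newton_approx`).

* In characteristic `p`, the element `y` is a root of an additive polynomial `∑ c_i X^(p^i)` whose
  coefficients are Laurent polynomials. Suppose that the terms `a_j x^(I_j)` of the expansion of `y`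
  have bounded values. In the value of the additive polynomial at a long partial sum the exponents
  `J + p^i I_j` occur, where `J` is an exponent of `c_i`, and since this value is close to zero all
  the terms below a certain bound cancel. By a descent in the lattice `ℤⁿ`, however, one of the
  exponents below this bound occurs only once (`exists_unique_exponent`).

For a valued field in which the Laurent polynomials are dense, the series `∑ a_I x^I` converge in
its completion, the valuation of a sum is that of its dominant term, and every element of the
completion is such a sum, with the coefficients of Laurent polynomials converging to it. So the
completion is the ring of formal sums (`exists_formalSums_equiv`). This applies both to `F` and to
`k(x₁, …, xₙ)`, and the isomorphism of their completions is the composite of the two isomorphisms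
with the ring of formal sums.
-/

noncomputable section

namespace MonomialValuation

/-! ### Laurent polynomials in elements of independent values -/

section Laurent

variable {k E : Type*} [Field k] [Field E] [Algebra k E] {n : ℕ}

/-- The Laurent monomial `x^I` in a family `x` of elements of a field. -/
def mon (x : Fin n → E) (I : Fin n → ℤ) : E := ∏ i, x i ^ I i

variable (k) in
/-- The data to which the argument applies, written additively: a real valuation `ν` trivial on
`k`, together with elements `x` whose monomials have pairwise different values `w I`, such that
every nonzero element of the field is congruent to a term `a x^I` modulo elements of larger
value. The last condition says that the monomials have all the values and `k` all the residues. -/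
structure IsMonomialSystem (ν : AddValuation E (WithTop ℝ)) (x : Fin n → E)
    (w : (Fin n → ℤ) →+ ℝ) : Prop where
  triv : ∀ c : k, c ≠ 0 → ν (algebraMap k E c) = 0
  inj : Function.Injective w
  val : ∀ I, ν (mon x I) = (w I : ℝ)
  immediate : ∀ y : E, y ≠ 0 → ∃ (a : k) (I : Fin n → ℤ),
    ν y < ν (y - algebraMap k E a * mon x I)

namespace IsMonomialSystem

variable {ν : AddValuation E (WithTop ℝ)} {x : Fin n → E} {w : (Fin n → ℤ) →+ ℝ}

lemma mon_ne_zero (h : IsMonomialSystem k ν x w) (I : Fin n → ℤ) : mon x I ≠ 0 := by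
  rw [← ν.ne_top_iff, h.val]
  exact WithTop.coe_ne_top

lemma ne_zero (h : IsMonomialSystem k ν x w) (i : Fin n) : x i ≠ 0 := by
  intro hi
  refine h.mon_ne_zero (Pi.single i 1) (Finset.prod_eq_zero (Finset.mem_univ i) ?_)
  simp [hi]

lemma mon_add (h : IsMonomialSystem k ν x w) (I J : Fin n → ℤ) :
    mon x (I + J) = mon x I * mon x J := by
  simp only [mon, ← Finset.prod_mul_distrib, Pi.add_apply]
  exact Finset.prod_congr rfl fun i _ => zpow_add₀ (h.ne_zero i) _ _

lemma mon_zero (x : Fin n → E) : mon x 0 = 1 := by simp [mon]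

lemma mon_nsmul (h : IsMonomialSystem k ν x w) (m : ℕ) (I : Fin n → ℤ) :
    mon x (m • I) = mon x I ^ m := by
  induction m with
  | zero => simp [mon_zero]
  | succ m ih => rw [succ_nsmul, h.mon_add, ih, pow_succ]

lemma val_term (h : IsMonomialSystem k ν x w) {a : k} (ha : a ≠ 0) (I : Fin n → ℤ) :
    ν (algebraMap k E a * mon x I) = (w I : ℝ) := by
  rw [ν.map_mul, h.triv a ha, h.val, zero_add]

open Classical in
/-- Terms with different exponents have different values, so that the value of their sum is the
least of these, and in particular at most that of any nonzero term. -/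
lemma val_sum_le_of_distinct (h : IsMonomialSystem k ν x w) (S : Finset (Fin n → ℤ))
    (b : (Fin n → ℤ) → k) {I : Fin n → ℤ} (hI : I ∈ S) (hb : b I ≠ 0) :
    ν (∑ J ∈ S, algebraMap k E (b J) * mon x J) ≤ (w I : ℝ) := by
  obtain ⟨J, hJ, hmin⟩ := Finset.exists_min_image (S.filter fun J => b J ≠ 0) w
    ⟨I, Finset.mem_filter.2 ⟨hI, hb⟩⟩
  rw [Finset.mem_filter] at hJ
  refine le_trans (le_of_eq ?_)
    (WithTop.coe_le_coe.2 (hmin I (Finset.mem_filter.2 ⟨hI, hb⟩)))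
  rw [← Finset.add_sum_erase _ _ hJ.1, ← h.val_term hJ.2]
  refine ν.map_add_eq_of_lt_left ?_
  rw [h.val_term hJ.2]
  refine ν.map_lt_sum WithTop.coe_ne_top fun K hK => ?_
  rw [Finset.mem_erase] at hK
  by_cases hbK : b K = 0
  · simp [hbK]
  · rw [h.val_term hbK, WithTop.coe_lt_coe]
    exact (hmin K (Finset.mem_filter.2 ⟨hK.2, hbK⟩)).lt_of_ne fun e => hK.1 (h.inj e).symm

open Classical in
/-- A term whose exponent occurs only once in a finite sum of terms cannot cancel. -/
lemma val_sum_le (h : IsMonomialSystem k ν x w) {ι : Type*} (T : Finset ι) (b : ι → k)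
    (e : ι → Fin n → ℤ) {t : ι} (ht : t ∈ T) (hb : b t ≠ 0)
    (he : ∀ s ∈ T, e s = e t → s = t) :
    ν (∑ s ∈ T, algebraMap k E (b s) * mon x (e s)) ≤ (w (e t) : ℝ) := by
  have key : ∑ s ∈ T, algebraMap k E (b s) * mon x (e s) =
      ∑ J ∈ T.image e, algebraMap k E (∑ s ∈ T with e s = J, b s) * mon x J := by
    rw [← Finset.sum_fiberwise_of_maps_to (g := e) (t := T.image e)
      fun s hs => Finset.mem_image_of_mem e hs]
    refine Finset.sum_congr rfl fun J _ => ?_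
    rw [map_sum, Finset.sum_mul]
    refine Finset.sum_congr rfl fun s hs => ?_
    rw [(Finset.mem_filter.1 hs).2]
  rw [key]
  refine h.val_sum_le_of_distinct _ (fun J => ∑ s ∈ T with e s = J, b s)
    (Finset.mem_image_of_mem e ht) ?_
  have : (T.filter fun s => e s = e t) = {t} := by
    ext s
    rw [Finset.mem_filter, Finset.mem_singleton]
    exact ⟨fun hs => he s hs.1 hs.2, by rintro rfl; exact ⟨ht, rfl⟩⟩
  simpa [this] using hb

/-- A nonzero element has a leading term. -/
lemma exists_lead (h : IsMonomialSystem k ν x w) {y : E} (hy : y ≠ 0) :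
    ∃ (a : k) (I : Fin n → ℤ), a ≠ 0 ∧ ν y = (w I : ℝ) ∧
      ν y < ν (y - algebraMap k E a * mon x I) := by
  obtain ⟨a, I, ha⟩ := h.immediate y hy
  have ha0 : a ≠ 0 := by
    rintro rfl
    simp at ha
  refine ⟨a, I, ha0, ?_, ha⟩
  rw [← h.val_term ha0]
  rw [ν.map_sub_swap] at ha
  exact (ν.map_eq_of_lt_sub ha).symm

variable (k) in
/-- The Laurent polynomials in `x`. -/
def laurent (x : Fin n → E) : Submodule k E := Submodule.span k (Set.range (mon x))

lemma mon_mem_laurent (x : Fin n → E) (I : Fin n → ℤ) : mon x I ∈ laurent k x :=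
  Submodule.subset_span ⟨I, rfl⟩

lemma term_mem_laurent (x : Fin n → E) (a : k) (I : Fin n → ℤ) :
    algebraMap k E a * mon x I ∈ laurent k x := by
  rw [← Algebra.smul_def]
  exact Submodule.smul_mem _ _ (mon_mem_laurent x I)

lemma one_mem_laurent (x : Fin n → E) : 1 ∈ laurent k x := by
  rw [← mon_zero x]
  exact mon_mem_laurent x 0

lemma mul_mem_laurent (h : IsMonomialSystem k ν x w) {y z : E} (hy : y ∈ laurent k x)
    (hz : z ∈ laurent k x) : y * z ∈ laurent k x := by
  have := Submodule.mul_mem_mul hy hz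
  rw [laurent, Submodule.span_mul_span] at this
  refine Submodule.span_mono ?_ this
  rintro _ ⟨_, ⟨I, rfl⟩, _, ⟨J, rfl⟩, rfl⟩
  exact ⟨I + J, h.mon_add I J⟩

lemma mem_laurent_iff {x : Fin n → E} {y : E} : y ∈ laurent k x ↔
    ∃ c : (Fin n → ℤ) →₀ k, ∑ I ∈ c.support, algebraMap k E (c I) * mon x I = y := by
  rw [laurent, Finsupp.mem_span_range_iff_exists_finsupp]
  simp only [Finsupp.sum, Algebra.smul_def]

/-! ### The closure of the ring of Laurent polynomials -/

/-- `y` is a limit of Laurent polynomials. -/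
def IsApprox (k : Type*) [Field k] [Algebra k E] (ν : AddValuation E (WithTop ℝ))
    (x : Fin n → E) (y : E) : Prop :=
  ∀ c : ℝ, ∃ l ∈ laurent k x, (c : WithTop ℝ) ≤ ν (y - l)

lemma _root_.AddValuation.exists_coe_le (ν : AddValuation E (WithTop ℝ)) (y : E) :
    ∃ c : ℝ, (c : WithTop ℝ) ≤ ν y := by
  cases h : ν y with
  | top => exact ⟨0, le_top⟩
  | coe a => exact ⟨a, le_rfl⟩

lemma isApprox_of_mem {y : E} (hy : y ∈ laurent k x) : IsApprox k ν x y :=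
  fun c => ⟨y, hy, by simp⟩

lemma IsApprox.add {y z : E} (hy : IsApprox k ν x y) (hz : IsApprox k ν x z) :
    IsApprox k ν x (y + z) := fun c => by
  obtain ⟨l, hl, hyl⟩ := hy c
  obtain ⟨m, hm, hzm⟩ := hz c
  refine ⟨l + m, add_mem hl hm, ?_⟩
  rw [add_sub_add_comm]
  exact ν.map_le_add hyl hzm

lemma isApprox_of_approx {y : E}
    (hy : ∀ c : ℝ, ∃ z, IsApprox k ν x z ∧ (c : WithTop ℝ) ≤ ν (y - z)) :
    IsApprox k ν x y := fun c => by
  obtain ⟨z, hz, hyz⟩ := hy c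
  obtain ⟨l, hl, hzl⟩ := hz c
  refine ⟨l, hl, ?_⟩
  rw [← sub_add_sub_cancel y z l]
  exact ν.map_le_add hyz hzl

lemma IsApprox.mul (h : IsMonomialSystem k ν x w) {y z : E} (hy : IsApprox k ν x y)
    (hz : IsApprox k ν x z) : IsApprox k ν x (y * z) := fun c => by
  obtain ⟨b, hb⟩ := ν.exists_coe_le y
  obtain ⟨m, hm, hzm⟩ := hz (c - b)
  obtain ⟨b', hb'⟩ := ν.exists_coe_le m
  obtain ⟨l, hl, hyl⟩ := hy (c - b')
  refine ⟨l * m, h.mul_mem_laurent hl hm, ?_⟩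
  rw [show y * z - l * m = y * (z - m) + (y - l) * m by ring]
  refine ν.map_le_add ?_ ?_
  · rw [ν.map_mul]
    refine le_trans (le_of_eq ?_) (add_le_add hb hzm)
    rw [← WithTop.coe_add, add_sub_cancel]
  · rw [ν.map_mul]
    refine le_trans (le_of_eq ?_) (add_le_add hyl hb')
    rw [← WithTop.coe_add, sub_add_cancel]

lemma IsApprox.pow (h : IsMonomialSystem k ν x w) {y : E} (hy : IsApprox k ν x y) (m : ℕ) :
    IsApprox k ν x (y ^ m) := by
  induction m with
  | zero => simpa using isApprox_of_mem (one_mem_laurent x)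
  | succ m ih => rw [pow_succ]; exact ih.mul h hy

/-- If `u` is the inverse of the leading term of `y`, then `g = 1 - u y` has positive value and
`y⁻¹ = u / (1 - g)` is the sum of a geometric series. -/
lemma IsApprox.inv (h : IsMonomialSystem k ν x w) {y : E} (hy : IsApprox k ν x y) :
    IsApprox k ν x y⁻¹ := by
  by_cases hy0 : y = 0
  · simpa [hy0] using isApprox_of_mem (zero_mem (laurent k x))
  obtain ⟨a, I, ha, hyI, hlt⟩ := h.exists_lead hy0
  have hterm : algebraMap k E a * mon x I ≠ 0 :=
    mul_ne_zero (by simpa using ha) (h.mon_ne_zero I)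
  set u : E := algebraMap k E a⁻¹ * mon x (-I) with hu
  have hut : u * (algebraMap k E a * mon x I) = 1 := by
    rw [hu, mul_mul_mul_comm, ← map_mul, inv_mul_cancel₀ ha, map_one, ← h.mon_add,
      neg_add_cancel, mon_zero, one_mul]
  have huν : ν u = ((-w I : ℝ) : WithTop ℝ) := by
    rw [hu, h.val_term (inv_ne_zero ha), map_neg]
  have hu0 : u ≠ 0 := left_ne_zero_of_mul_eq_one hut
  set g : E := 1 - u * y with hg
  have hgpos : 0 < ν g := by
    have : g = -(u * (y - algebraMap k E a * mon x I)) := by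
      rw [mul_sub, hut, hg]; ring
    rw [this, ν.map_neg, ν.map_mul, huν]
    rw [hyI] at hlt
    cases hd : ν (y - algebraMap k E a * mon x I) with
    | top => simp
    | coe d =>
      rw [hd, WithTop.coe_lt_coe] at hlt
      rw [← WithTop.coe_add, ← WithTop.coe_zero, WithTop.coe_lt_coe]
      linarith
  obtain ⟨δ, hδ, hδg⟩ : ∃ δ : ℝ, 0 < δ ∧ (δ : WithTop ℝ) ≤ ν g := by
    cases hd : ν g with
    | top => exact ⟨1, one_pos, le_top⟩
    | coe d =>
      rw [hd, ← WithTop.coe_zero, WithTop.coe_lt_coe] at hgpos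
      exact ⟨d, hgpos, le_rfl⟩
  have hgA : IsApprox k ν x g := by
    have h1 := (isApprox_of_mem (ν := ν) (term_mem_laurent x (-a⁻¹) (-I))).mul h hy
    have h2 := (isApprox_of_mem (ν := ν) (one_mem_laurent (k := k) x)).add h1
    convert h2 using 1
    rw [hg, hu, map_neg]; ring
  refine isApprox_of_approx fun c => ?_
  obtain ⟨m, hm⟩ := exists_nat_gt ((c + w I) / δ)
  refine ⟨u * ∑ i ∈ Finset.range m, g ^ i, ?_, ?_⟩
  · refine (isApprox_of_mem (term_mem_laurent x _ _)).mul h ?_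
    exact Finset.sum_induction _ (IsApprox k ν x) (fun _ _ => IsApprox.add)
      (isApprox_of_mem (zero_mem _)) fun i _ => hgA.pow h i
  · have hgeom : y⁻¹ - u * ∑ i ∈ Finset.range m, g ^ i = y⁻¹ * g ^ m := by
      have := mul_neg_geom_sum g m
      rw [show 1 - g = u * y by rw [hg]; ring] at this
      field_simp
      linear_combination -this
    rw [hgeom, ν.map_mul, ν.map_pow]
    have hyinv : ν y⁻¹ = ((-w I : ℝ) : WithTop ℝ) := by
      rw [ν.map_inv, hyI]; rfl
    rw [hyinv]
    refine le_trans ?_ (add_le_add le_rfl (nsmul_le_nsmul_right hδg m))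
    rw [← WithTop.coe_nsmul, ← WithTop.coe_add, WithTop.coe_le_coe, nsmul_eq_mul]
    rw [div_lt_iff₀ hδ] at hm
    linarith

/-- The closure of the ring of Laurent polynomials; it is a field. -/
def closureField (h : IsMonomialSystem k ν x w) : IntermediateField k E where
  carrier := {y | IsApprox k ν x y}
  mul_mem' hy hz := IsApprox.mul h hy hz
  add_mem' hy hz := IsApprox.add hy hz
  algebraMap_mem' a := isApprox_of_mem (by simpa [mon_zero] using term_mem_laurent x a 0)
  inv_mem' _ hy := IsApprox.inv h hy

end IsMonomialSystem
end Laurent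

/-! ### Approximation by Newton's method in characteristic zero -/

section CharZero

open Polynomial Filter Topology

variable {F : Type*} [Field F]

/-- The terms `b j + j γ` on a finite set have a minimum, and among the indices where it is
attained there is a largest. -/
lemma exists_last_min {S : Finset ℕ} (hS : S.Nonempty) (b : ℕ → ℝ) (γ : ℝ) :
    ∃ h ∈ S, (∀ j ∈ S, b h + h * γ ≤ b j + j * γ) ∧
      ∀ j ∈ S, h < j → b h + h * γ < b j + j * γ := by
  obtain ⟨i, hi, hmin⟩ := S.exists_min_image (fun j => b j + j * γ) hS
  obtain ⟨h, hh, hmax⟩ := (S.filter fun j => b j + j * γ = b i + i * γ).exists_max_image id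
    ⟨i, Finset.mem_filter.2 ⟨hi, rfl⟩⟩
  rw [Finset.mem_filter] at hh
  refine ⟨h, hh.1, fun j hj => hh.2 ▸ hmin j hj, fun j hj hlt => ?_⟩
  refine lt_of_le_of_ne (hh.2 ▸ hmin j hj) fun he => ?_
  have := hmax j (Finset.mem_filter.2 ⟨hj, he ▸ hh.2⟩)
  exact absurd hlt (not_lt.2 this)

lemma val_natCast_nonneg (ν : AddValuation F (WithTop ℝ)) (m : ℕ) : 0 ≤ ν (m : F) := by
  induction m with
  | zero => simp
  | succ m ih =>
    rw [Nat.cast_succ]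
    exact ν.map_le_add ih ν.map_one.ge

lemma val_le_natCast_mul (ν : AddValuation F (WithTop ℝ)) (m : ℕ) (y : F) :
    ν y ≤ ν (m * y) := by
  rw [ν.map_mul]
  exact le_add_of_nonneg_left (val_natCast_nonneg ν m)

/-- Let `y` be algebraic over a subfield `C`, and let `γ` be the supremum of the values
`ν (y - z)`, for `z ∈ C`. If the residue characteristic is zero, then this supremum is attained
or exceeded. Indeed, expand a polynomial relation `Q (y) = 0` around `y` and let `h` be the last
index for which the value of the term of order `h` at distance `γ` from `y` is minimal. The
divided derivative `f` of `Q` of order `h - 1` is dominated by its linear term, so that a single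
Newton step `z - f z / f' z` leads from a sufficiently good approximation `z` to one as good
as `γ`. -/
theorem exists_newton_approx (ν : AddValuation F (WithTop ℝ))
    (hν : ∀ m : ℕ, m ≠ 0 → ν (m : F) = 0) (C : Subfield F) {y : F} (hy : IsAlgebraic C y) {γ : ℝ}
    (hne : {τ : ℝ | ∃ z ∈ C, ν (z - y) = τ}.Nonempty)
    (hγ : IsLUB {τ : ℝ | ∃ z ∈ C, ν (z - y) = τ} γ) :
    ∃ z ∈ C, (γ : WithTop ℝ) ≤ ν (z - y) := by
  obtain ⟨Q, hQ0, hQ⟩ := hy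
  set P : F[X] := taylor y (Q.map (algebraMap C F)) with hP
  have hP0 : P ≠ 0 := by
    rw [hP, Ne, taylor_eq_zero]
    exact (Polynomial.map_ne_zero_iff (algebraMap C F).injective).2 hQ0
  set b : ℕ → ℝ := fun j => (ν (P.coeff j)).untopD 0 with hb
  have hbν : ∀ j ∈ P.support, ν (P.coeff j) = (b j : ℝ) := fun j hj => by
    have : ν (P.coeff j) ≠ ⊤ := ν.ne_top_iff.2 (mem_support_iff.1 hj)
    obtain ⟨c, hc⟩ := WithTop.ne_top_iff_exists.1 this
    simp [hb, ← hc]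
  obtain ⟨h, hhS, hmin, hlast⟩ := exists_last_min (nonempty_support_iff.2 hP0) b γ
  have hh0 : h ≠ 0 := by
    rintro rfl
    rw [mem_support_iff, hP, taylor_coeff_zero, eval_map_algebraMap] at hhS
    exact hhS hQ
  obtain ⟨d, rfl⟩ : ∃ d, h = d + 1 := ⟨h - 1, by omega⟩
  set f : C[X] := hasseDeriv d Q with hf
  set g : F[X] := taylor y (f.map (algebraMap C F)) with hg
  have hgc : ∀ s, g.coeff s = ((s + d).choose s : F) * P.coeff (s + d) := fun s => by
    have e : f.map (algebraMap C F) = hasseDeriv d (Q.map (algebraMap C F)) := by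
      ext i; simp [hf, hasseDeriv_coeff]
    rw [hg, hP, taylor_coeff, taylor_coeff, e, ← LinearMap.comp_apply, hasseDeriv_comp]
    simp
  -- a good approximation `z₀`, at distance `τ` from `y`
  have hev : ∀ᶠ τ : ℝ in 𝓝 γ, ∀ j ∈ P.support, d + 1 < j →
      b (d + 1) + γ < b j + ((j - d : ℕ) : ℝ) * τ ∧
        b (d + 1) < b j + ((j - d - 1 : ℕ) : ℝ) * τ := by
    rw [Filter.eventually_all_finset]
    intro j hj
    by_cases hdj : d + 1 < j
    · have hl := hlast j hj hdj
      push_cast at hl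
      have h1 : ((j - d : ℕ) : ℝ) = j - d := by rw [Nat.cast_sub (by omega)]
      have h2 : ((j - d - 1 : ℕ) : ℝ) = j - d - 1 := by
        rw [Nat.cast_sub (by omega), h1, Nat.cast_one]
      have e1 : ∀ᶠ τ : ℝ in 𝓝 γ, b (d + 1) + γ < b j + ((j - d : ℕ) : ℝ) * τ := by
        have hc : Continuous fun τ : ℝ => b j + ((j - d : ℕ) : ℝ) * τ := by fun_prop
        refine hc.continuousAt.eventually (lt_mem_nhds ?_)
        rw [h1]; linarith
      have e2 : ∀ᶠ τ : ℝ in 𝓝 γ, b (d + 1) < b j + ((j - d - 1 : ℕ) : ℝ) * τ := by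
        have hc : Continuous fun τ : ℝ => b j + ((j - d - 1 : ℕ) : ℝ) * τ := by fun_prop
        refine hc.continuousAt.eventually (lt_mem_nhds ?_)
        rw [h2]; linarith
      filter_upwards [e1, e2] with τ h1 h2 _ using ⟨h1, h2⟩
    · exact Eventually.of_forall fun τ h => absurd h hdj
  obtain ⟨τ, ⟨z₀, hz₀, hτ⟩, hτj⟩ :=
    ((hγ.frequently_mem hne).and_eventually (hev.filter_mono nhdsWithin_le_nhds)).exists
  set t : F := z₀ - y with ht
  have hft : aeval z₀ f = g.eval t := by
    rw [hg, ht, taylor_eval, sub_add_cancel, eval_map_algebraMap]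
  have hft' : aeval z₀ (derivative f) = (derivative g).eval t := by
    rw [hg, ht, taylor_apply, derivative_comp, eval_mul, eval_comp, derivative_map]
    simp [eval_map_algebraMap]
  have hνt : ∀ (j s : ℕ), j ∈ P.support →
      ν (P.coeff j * t ^ s) = ((b j + (s : ℝ) * τ : ℝ) : WithTop ℝ) := fun j s hj => by
    rw [ν.map_mul, ν.map_pow, hbν j hj, hτ, ← WithTop.coe_nsmul, ← WithTop.coe_add, nsmul_eq_mul]
  -- the derivative is dominated by its constant term
  have hder : ν ((derivative g).eval t) = (b (d + 1) : ℝ) := by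
    rw [eval_eq_sum_range, Finset.sum_range_succ', pow_zero, mul_one, add_comm]
    have hconst : ν ((derivative g).coeff 0) = (b (d + 1) : ℝ) := by
      rw [coeff_derivative, hgc, zero_add, add_comm 1 d, Nat.choose_one_right, Nat.cast_zero,
        zero_add, mul_one, ν.map_mul, hν _ (Nat.succ_ne_zero d), zero_add, hbν _ hhS]
    rw [← hconst]
    refine ν.map_add_eq_of_lt_left ?_
    rw [hconst]
    refine ν.map_lt_sum WithTop.coe_ne_top fun s _ => ?_
    have e : (derivative g).coeff (s + 1) * t ^ (s + 1) =
        (((s + 2) * (s + 2 + d).choose (s + 2) : ℕ) : F) * (P.coeff (s + 2 + d) * t ^ (s + 1)) := by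
      rw [coeff_derivative, hgc]; push_cast; ring
    rw [e]
    refine lt_of_lt_of_le ?_ (val_le_natCast_mul ν _ _)
    by_cases hj : s + 2 + d ∈ P.support
    · rw [hνt _ _ hj, WithTop.coe_lt_coe]
      have := (hτj _ hj (by omega)).2
      rwa [show s + 2 + d - d - 1 = s + 1 by omega] at this
    · rw [notMem_support_iff.1 hj]; simp
  have hnum : ((b (d + 1) + γ : ℝ) : WithTop ℝ) ≤ ν (t * (derivative g).eval t - g.eval t) := by
    have e : t * (derivative g).eval t - g.eval t = (X * derivative g - g).eval t := by simp
    rw [e, eval_eq_sum_range]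
    refine ν.map_le_sum fun s _ => ?_
    rcases s with _ | _ | s
    · have : (X * derivative g - g).coeff 0 * t ^ 0 = -P.coeff d := by
        simp [hgc]
      rw [this, ν.map_neg]
      by_cases hj : d ∈ P.support
      · rw [hbν _ hj, WithTop.coe_le_coe]
        have := hmin d hj
        push_cast at this
        linarith
      · rw [notMem_support_iff.1 hj]; simp
    · have : (X * derivative g - g).coeff (0 + 1) = 0 := by
        rw [coeff_sub, coeff_X_mul, coeff_derivative]; simp
      rw [this]; simp
    · have : (X * derivative g - g).coeff (s + 1 + 1) * t ^ (s + 1 + 1) =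
          (((s + 1) * (s + 2 + d).choose (s + 2) : ℕ) : F) *
            (P.coeff (s + 2 + d) * t ^ (s + 2)) := by
        rw [coeff_sub, coeff_X_mul, coeff_derivative, hgc]; push_cast; ring
      rw [this]
      refine le_trans ?_ (val_le_natCast_mul ν _ _)
      by_cases hj : s + 2 + d ∈ P.support
      · rw [hνt _ _ hj, WithTop.coe_le_coe]
        have := (hτj _ hj (by omega)).1
        rw [show s + 2 + d - d = s + 2 by omega] at this
        exact this.le
      · rw [notMem_support_iff.1 hj]; simp
  have hD0 : (derivative g).eval t ≠ 0 := by
    rw [← ν.ne_top_iff, hder]; exact WithTop.coe_ne_top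
  refine ⟨z₀ - aeval z₀ f / aeval z₀ (derivative f), ?_, ?_⟩
  · have hmem : ∀ p : C[X], aeval z₀ p ∈ C := fun p => by
      have : aeval z₀ p = algebraMap C F (p.eval ⟨z₀, hz₀⟩) := by
        rw [← aeval_algebraMap_apply_eq_algebraMap_eval]; rfl
      rw [this]
      exact (p.eval ⟨z₀, hz₀⟩).2
    exact sub_mem hz₀ (div_mem (hmem _) (hmem _))
  · rw [hft, hft']
    have e : z₀ - g.eval t / (derivative g).eval t - y =
        (t * (derivative g).eval t - g.eval t) / (derivative g).eval t := by
      rw [sub_div, mul_div_cancel_right₀ _ hD0, ht]; ring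
    rw [e]
    rw [← div_mul_cancel₀ (t * (derivative g).eval t - g.eval t) hD0, ν.map_mul, hder] at hnum
    cases hc : ν ((t * (derivative g).eval t - g.eval t) / (derivative g).eval t) with
    | top => exact le_top
    | coe c =>
      rw [hc, ← WithTop.coe_add, WithTop.coe_le_coe] at hnum
      rw [WithTop.coe_le_coe]; linarith

variable {k : Type*} [Field k] [Algebra k F] {n : ℕ} {ν : AddValuation F (WithTop ℝ)}
  {x : Fin n → F} {w : (Fin n → ℤ) →+ ℝ}

/-- In characteristic zero an element which is algebraic over the closure of the Laurent
polynomials belongs to it: the supremum of its distances would not be attained otherwise, as any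
approximation can be improved by the leading term of the difference. -/
theorem IsMonomialSystem.isApprox_of_charZero [CharZero k] (h : IsMonomialSystem k ν x w) {y : F}
    (hy : IsAlgebraic h.closureField y) : IsApprox k ν x y := by
  by_contra hyC
  have hν : ∀ m : ℕ, m ≠ 0 → ν (m : F) = 0 := fun m hm => by
    rw [← map_natCast (algebraMap k F)]
    exact h.triv _ (Nat.cast_ne_zero.2 hm)
  set D : Set ℝ := {τ : ℝ | ∃ z ∈ h.closureField.toSubfield, ν (z - y) = τ} with hD
  have himp : ∀ z, IsApprox k ν x z → ∃ τ : ℝ, ν (z - y) = τ ∧ ∃ τ' ∈ D, τ < τ' := by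
    have hval : ∀ z, IsApprox k ν x z → ∃ τ : ℝ, ν (z - y) = τ := fun z hz => by
      have : ν (z - y) ≠ ⊤ := ν.ne_top_iff.2 fun e => hyC (sub_eq_zero.1 e ▸ hz)
      exact ⟨_, (WithTop.coe_untop _ this).symm⟩
    intro z hz
    obtain ⟨τ, hτ⟩ := hval z hz
    obtain ⟨a, I, ha⟩ := h.immediate (z - y) fun e => hyC (sub_eq_zero.1 e ▸ hz)
    have hz' : IsApprox k ν x (z - algebraMap k F a * mon x I) := by
      have := hz.add (isApprox_of_mem (ν := ν) (term_mem_laurent x (-a) I))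
      simpa [sub_eq_add_neg] using this
    obtain ⟨τ', hτ'⟩ := hval _ hz'
    refine ⟨τ, hτ, τ', ⟨_, hz', hτ'⟩, ?_⟩
    rw [sub_right_comm, hτ, hτ', WithTop.coe_lt_coe] at ha
    exact ha
  have hne : D.Nonempty := by
    obtain ⟨τ, -, τ', hτ', -⟩ := himp 0 (isApprox_of_mem (zero_mem _))
    exact ⟨τ', hτ'⟩
  by_cases hbdd : BddAbove D
  · obtain ⟨z, hz, hγz⟩ := exists_newton_approx ν hν h.closureField.toSubfield hy hne
      (isLUB_csSup hne hbdd)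
    obtain ⟨τ, hτ, τ', hτ', hlt⟩ := himp z hz
    rw [hτ, WithTop.coe_le_coe] at hγz
    exact absurd (le_csSup hbdd hτ') (not_le.2 (hγz.trans_lt hlt))
  · refine hyC (isApprox_of_approx fun c => ?_)
    rw [not_bddAbove_iff] at hbdd
    obtain ⟨τ, ⟨z, hz, hτ⟩, hc⟩ := hbdd c
    refine ⟨z, hz, ?_⟩
    rw [ν.map_sub_swap, hτ, WithTop.coe_le_coe]
    exact hc.le

end CharZero

/-! ### Approximation by additive polynomials in characteristic `p` -/

section CharP

open Filter Topology

variable {n : ℕ} {w : (Fin n → ℤ) →+ ℝ}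

/-- A discreteness property of `ℤⁿ`: a set of vectors without zero in which every vector is a
proper multiple of another one is empty. -/
lemma not_forall_eq_nsmul {ι : Type*} (P : ι → Prop) (u : ι → Fin n → ℤ)
    (hu : ∀ j, P j → u j ≠ 0)
    (hdiv : ∀ j, P j → ∃ j', P j' ∧ ∃ m : ℕ, 2 ≤ m ∧ u j = m • u j') (j : ι) : ¬ P j := by
  suffices ∀ (M : ℕ) (j : ι), P j → ∑ i, (u j i).natAbs = M → False from
    fun hj => this _ j hj rfl
  intro M
  induction M using Nat.strong_induction_on with
  | _ M ih =>
    intro j hj hM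
    obtain ⟨j', hj', m, hm, he⟩ := hdiv j hj
    refine ih _ ?_ j' hj' rfl
    have hpos : 0 < ∑ i, (u j' i).natAbs := by
      obtain ⟨i, hi⟩ := Function.ne_iff.1 (hu j' hj')
      exact Finset.sum_pos' (fun _ _ => Nat.zero_le _)
        ⟨i, Finset.mem_univ i, Int.natAbs_pos.2 hi⟩
    have hsum : ∑ i, (u j i).natAbs = m * ∑ i, (u j' i).natAbs := by
      rw [he, Finset.mul_sum]
      exact Finset.sum_congr rfl fun i _ => by simp [Int.natAbs_mul]
    nlinarith

/-- Let `I₀, I₁, …` be exponents whose weights increase to a limit `γ`, and `S` a finite set of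
pairs `(i, J)`. Then among the exponents `J + p^i I_j` there is one which occurs only once, and it
can be taken of weight less than all the limits `w J + p^i γ`.

To see this, let `(i₀, J₀)` have the least limit and, among those, the least `i₀`. If
`J₀ + p^i₀ I_j` is not unique, then for large `j` it is equal to some `J + p^i I_j'` with the same
limit and `i > i₀`, so that the difference between `I_j` and the "limit exponent" is `p^(i - i₀)`
times the corresponding difference for `I_j'`. A common multiple of these differences is a family
of lattice vectors, to which `not_forall_eq_nsmul` applies. -/
theorem exists_unique_exponent {p : ℕ} (hp : 2 ≤ p) (hw : Function.Injective w)
    {I : ℕ → Fin n → ℤ} (hI : StrictMono fun j => w (I j)) {γ : ℝ}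
    (hγ : Tendsto (fun j => w (I j)) atTop (𝓝 γ)) {S : Finset (ℕ × (Fin n → ℤ))}
    (hS : S.Nonempty) :
    ∃ s ∈ S, ∃ j,
      (∀ s' ∈ S, ∀ j', s'.2 + p ^ s'.1 • I j' = s.2 + p ^ s.1 • I j → s' = s ∧ j' = j) ∧
      ∀ s' ∈ S, w (s.2 + p ^ s.1 • I j) < w s'.2 + (p : ℝ) ^ s'.1 * γ := by
  classical
  have hp0 : ∀ i : ℕ, (0 : ℝ) < (p : ℝ) ^ i := fun i => by
    have : (0 : ℝ) < p := by exact_mod_cast (by omega : 0 < p)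
    positivity
  have hwt : ∀ (s : ℕ × (Fin n → ℤ)) j,
      w (s.2 + p ^ s.1 • I j) = w s.2 + (p : ℝ) ^ s.1 * w (I j) := fun s j => by
    rw [map_add, map_nsmul, nsmul_eq_mul]; push_cast; rfl
  have hlt : ∀ j, w (I j) < γ := fun j =>
    (hI (Nat.lt_succ_self j)).trans_le (hI.monotone.ge_of_tendsto hγ _)
  set lv : ℕ × (Fin n → ℤ) → ℝ := fun s => w s.2 + (p : ℝ) ^ s.1 * γ with hlv
  obtain ⟨s₁, hs₁, hmin₁⟩ := S.exists_min_image lv hS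
  obtain ⟨s₀, hs₀, hmin₀⟩ := (S.filter fun s => lv s = lv s₁).exists_min_image Prod.fst
    ⟨s₁, Finset.mem_filter.2 ⟨hs₁, rfl⟩⟩
  rw [Finset.mem_filter] at hs₀
  have hmin : ∀ s ∈ S, lv s₀ ≤ lv s := fun s hs => hs₀.2 ▸ hmin₁ s hs
  have hless : ∀ j, ∀ s ∈ S, w (s₀.2 + p ^ s₀.1 • I j) < lv s := fun j s hs => by
    refine lt_of_lt_of_le ?_ (hmin s hs)
    rw [hwt, hlv]
    have := mul_lt_mul_of_pos_left (hlt j) (hp0 s₀.1)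
    simpa using this
  by_contra hcon
  have hrep : ∀ j, ∃ s ∈ S, ∃ j', s.2 + p ^ s.1 • I j' = s₀.2 + p ^ s₀.1 • I j ∧
      ¬ (s = s₀ ∧ j' = j) := fun j => by
    by_contra hc
    refine hcon ⟨s₀, hs₀.1, j, fun s hs j' he => ?_, hless j⟩
    by_contra hne
    exact hc ⟨s, hs, j', he, hne⟩
  -- a pair with a larger limit yields only finitely many exponents of weight less than `lv s₀`
  have hfar : ∀ᶠ j in atTop, ∀ s ∈ S, lv s₀ < lv s →
      ∀ j', s.2 + p ^ s.1 • I j' ≠ s₀.2 + p ^ s₀.1 • I j := by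
    rw [Filter.eventually_all_finset]
    intro s hs
    by_cases hls : lv s₀ < lv s
    · have ht : Tendsto (fun j' => w (s.2 + p ^ s.1 • I j')) atTop (𝓝 (lv s)) := by
        simp only [hwt, hlv]
        exact (hγ.const_mul _).const_add _
      obtain ⟨N, hN⟩ := eventually_atTop.1 (ht.eventually (lt_mem_nhds hls))
      have hfin : ∀ᶠ j in atTop, ∀ j' ∈ Finset.range N,
          s.2 + p ^ s.1 • I j' ≠ s₀.2 + p ^ s₀.1 • I j := by
        rw [Filter.eventually_all_finset]
        intro j' _
        by_cases hex : ∃ j₁, s.2 + p ^ s.1 • I j' = s₀.2 + p ^ s₀.1 • I j₁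
        · obtain ⟨j₁, hj₁⟩ := hex
          filter_upwards [eventually_gt_atTop j₁] with j hj he
          rw [hj₁] at he
          have := congrArg w he
          rw [hwt, hwt] at this
          have h2 := mul_left_cancel₀ (hp0 s₀.1).ne' (add_left_cancel this)
          exact absurd (hI hj) (by simp [h2])
        · exact Eventually.of_forall fun j he => hex ⟨j, he⟩
      filter_upwards [hfin] with j hj _ j' he
      by_cases hj' : j' < N
      · exact hj j' (Finset.mem_range.2 hj') he
      · have h1 := hN j' (not_lt.1 hj')
        rw [he] at h1
        exact absurd h1 (hless j s₀ hs₀.1).asymm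
    · exact Eventually.of_forall fun j h => absurd h hls
  obtain ⟨N, hN⟩ := eventually_atTop.1 hfar
  have hstep : ∀ j, N ≤ j → ∃ s ∈ S, lv s = lv s₀ ∧ s₀.1 < s.1 ∧ ∃ j', N ≤ j' ∧
      (p : ℝ) ^ s₀.1 * (w (I j) - γ) = (p : ℝ) ^ s.1 * (w (I j') - γ) := fun j hj => by
    obtain ⟨s, hs, j', he, hne⟩ := hrep j
    have hls : lv s = lv s₀ := by
      by_contra hc
      exact hN j hj s hs (lt_of_le_of_ne (hmin s hs) (Ne.symm hc)) j' he
    have hle : s₀.1 ≤ s.1 := hmin₀ s (Finset.mem_filter.2 ⟨hs, hls.trans hs₀.2⟩)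
    have hwe := congrArg w he
    rw [hwt, hwt] at hwe
    have hls' := hls
    simp only [hlv] at hls'
    have hdiff : (p : ℝ) ^ s₀.1 * (w (I j) - γ) = (p : ℝ) ^ s.1 * (w (I j') - γ) := by
      linarith
    have hslt : s₀.1 < s.1 := by
      refine lt_of_le_of_ne hle fun hi => hne ?_
      rw [← hi] at hls' hwe
      have h2 : s.2 = s₀.2 := hw (by linarith)
      rw [h2] at hwe
      have h3 := mul_left_cancel₀ (hp0 s₀.1).ne' (add_left_cancel hwe)
      exact ⟨Prod.ext hi.symm h2, hI.injective h3⟩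
    refine ⟨s, hs, hls, hslt, j', ?_, hdiff⟩
    have hpow : (p : ℝ) ^ s₀.1 < (p : ℝ) ^ s.1 :=
      pow_lt_pow_right₀ (by exact_mod_cast (by omega : 1 < p)) hslt
    refine hj.trans (hI.le_iff_le.1 ?_)
    have h1 := hlt j'
    nlinarith [hp0 s₀.1]
  obtain ⟨s₂, -, hls₂, hlt₂, -⟩ := hstep N le_rfl
  -- `D` times the "limit exponent" is the lattice vector `H`
  set D : ℕ := p ^ s₂.1 - p ^ s₀.1 with hD
  have hpow : p ^ s₀.1 < p ^ s₂.1 := Nat.pow_lt_pow_right (by omega) hlt₂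
  have hDr : (D : ℝ) = (p : ℝ) ^ s₂.1 - (p : ℝ) ^ s₀.1 := by
    rw [hD, Nat.cast_sub hpow.le]; push_cast; rfl
  have hD0 : (0 : ℝ) < D := by exact_mod_cast (by omega : 0 < D)
  have hwu : ∀ j, w (D • I j - (s₀.2 - s₂.2)) = D * (w (I j) - γ) := fun j => by
    rw [map_sub, map_nsmul, map_sub, nsmul_eq_mul]
    simp only [hlv] at hls₂
    linear_combination hls₂ + γ * hDr
  refine not_forall_eq_nsmul (fun j => N ≤ j) (fun j => D • I j - (s₀.2 - s₂.2)) ?_ ?_ N le_rfl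
  · intro j _ h0
    have h1 := hwu j
    rw [h0, map_zero] at h1
    nlinarith [hlt j]
  · intro j hj
    obtain ⟨s, -, -, hslt, j', hj', he⟩ := hstep j hj
    refine ⟨j', hj', p ^ (s.1 - s₀.1), ?_, hw ?_⟩
    · calc 2 ≤ p := hp
        _ = p ^ 1 := (pow_one p).symm
        _ ≤ p ^ (s.1 - s₀.1) := Nat.pow_le_pow_right (by omega) (by omega)
    · rw [map_nsmul, hwu, hwu, nsmul_eq_mul]
      refine mul_left_cancel₀ (hp0 s₀.1).ne' ?_
      have e : (p : ℝ) ^ s₀.1 * (p : ℝ) ^ (s.1 - s₀.1) = (p : ℝ) ^ s.1 := by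
        rw [← pow_add]; congr 1; omega
      push_cast
      linear_combination (D : ℝ) * he - D * (w (I j') - γ) * e

variable {k F : Type*} [Field k] [Field F] [Algebra k F]

open scoped IntermediateField.algebraAdjoinAdjoin in
/-- An element which is algebraic over the field generated by a set `X` is a root of a nonzero
additive polynomial, whose coefficients can be taken in the ring generated by `X`. -/
lemma exists_additive_relation (p : ℕ) (X : Set F) {y : F}
    (hy : IsAlgebraic (IntermediateField.adjoin k X) y) :
    ∃ c : ℕ →₀ Algebra.adjoin k X, c ≠ 0 ∧
      ∑ i ∈ c.support, (c i : F) * y ^ p ^ i = 0 := by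
  set K := IntermediateField.adjoin k X
  have hdep : ¬ LinearIndependent (Algebra.adjoin k X) (fun i : ℕ => y ^ p ^ i) := by
    rw [LinearIndependent.iff_fractionRing (Algebra.adjoin k X) K]
    intro hli
    have : FiniteDimensional K (IntermediateField.adjoin K {y}) :=
      IntermediateField.adjoin.finiteDimensional hy.isIntegral
    have hy' : y ∈ IntermediateField.adjoin K {y} := IntermediateField.mem_adjoin_simple_self K y
    have hli' : LinearIndependent K
        (fun i : ℕ => (⟨y, hy'⟩ : IntermediateField.adjoin K {y}) ^ p ^ i) :=
      LinearIndependent.of_comp (IntermediateField.adjoin K {y}).val.toLinearMap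
        (by simpa [Function.comp_def] using hli)
    exact not_finite_iff_infinite.2 inferInstance hli'.finite
  rw [linearIndependent_iff] at hdep
  push Not at hdep
  obtain ⟨c, hc, hc0⟩ := hdep
  refine ⟨c, hc0, ?_⟩
  rw [Finsupp.linearCombination_apply] at hc
  exact hc

variable {ν : AddValuation F (WithTop ℝ)} {x : Fin n → F}

lemma IsMonomialSystem.adjoin_le_laurent (h : IsMonomialSystem k ν x w) {y : F}
    (hy : y ∈ Algebra.adjoin k (Set.range x)) : y ∈ laurent k x := by
  induction hy using Algebra.adjoin_induction with
  | mem y hy =>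
    obtain ⟨i, rfl⟩ := hy
    convert mon_mem_laurent (k := k) x (Pi.single i 1) using 1
    rw [mon, Finset.prod_eq_single i]
    · simp
    · intro j _ hj; simp [hj]
    · simp
  | algebraMap a => simpa [mon_zero] using term_mem_laurent x a 0
  | add y z _ _ hy hz => exact add_mem hy hz
  | mul y z _ _ hy hz => exact h.mul_mem_laurent hy hz

/-- Repeatedly subtracting leading terms from an element which is not a limit of Laurent
polynomials yields an infinite expansion whose terms have increasing, but bounded values. -/
lemma IsMonomialSystem.exists_expansion (h : IsMonomialSystem k ν x w) {y : F}
    (hy : ¬ IsApprox k ν x y) :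
    ∃ (a : ℕ → k) (I : ℕ → Fin n → ℤ), (∀ j, a j ≠ 0) ∧ (StrictMono fun j => w (I j)) ∧
      (∃ γ, Tendsto (fun j => w (I j)) atTop (𝓝 γ)) ∧
      ∀ m, ν (y - ∑ j ∈ Finset.range m, algebraMap k F (a j) * mon x (I j)) = (w (I m) : ℝ) := by
  have hlead : ∀ r : F, ∃ (a : k) (I : Fin n → ℤ), r ≠ 0 → a ≠ 0 ∧ ν r = (w I : ℝ) ∧
      ν r < ν (r - algebraMap k F a * mon x I) := fun r => by
    by_cases hr : r = 0
    · exact ⟨0, 0, fun h => absurd hr h⟩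
    · obtain ⟨a, I, h⟩ := h.exists_lead hr
      exact ⟨a, I, fun _ => h⟩
  choose A J hAJ using hlead
  let r : ℕ → F := fun m => (fun r => r - algebraMap k F (A r) * mon x (J r))^[m] y
  have hr : ∀ m, r (m + 1) = r m - algebraMap k F (A (r m)) * mon x (J (r m)) :=
    fun m => Function.iterate_succ_apply' _ _ _
  have hsum : ∀ m, y - ∑ j ∈ Finset.range m,
      algebraMap k F (A (r j)) * mon x (J (r j)) = r m := fun m => by
    induction m with
    | zero => simp [r]
    | succ m ih => rw [Finset.sum_range_succ, ← sub_sub, ih, hr]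
  have hmem : ∀ m, ∑ j ∈ Finset.range m,
      algebraMap k F (A (r j)) * mon x (J (r j)) ∈ laurent k x :=
    fun m => sum_mem fun j _ => term_mem_laurent x _ _
  have hr0 : ∀ m, r m ≠ 0 := fun m h0 => by
    rw [← hsum, sub_eq_zero] at h0
    exact hy (h0 ▸ isApprox_of_mem (hmem m))
  have hmono : StrictMono fun j => w (J (r j)) := strictMono_nat_of_lt_succ fun m => by
    have h1 := (hAJ _ (hr0 m)).2.2
    rw [← hr, (hAJ _ (hr0 m)).2.1, (hAJ _ (hr0 (m + 1))).2.1, WithTop.coe_lt_coe] at h1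
    exact h1
  refine ⟨fun j => A (r j), fun j => J (r j), fun j => (hAJ _ (hr0 j)).1, hmono, ?_,
    fun m => by rw [hsum, (hAJ _ (hr0 m)).2.1]⟩
  refine ⟨_, tendsto_atTop_ciSup hmono.monotone ?_⟩
  by_contra hb
  rw [not_bddAbove_iff] at hb
  refine hy fun c => ?_
  obtain ⟨_, ⟨m, rfl⟩, hm⟩ := hb c
  refine ⟨_, hmem m, ?_⟩
  rw [hsum, (hAJ _ (hr0 m)).2.1, WithTop.coe_le_coe]
  exact hm.le

/-- In characteristic `p` an element which is algebraic over the field generated by the `x i` is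
a limit of Laurent polynomials. Otherwise substitute the partial sums of its infinite expansion
`∑ a_j x^I_j` into an additive polynomial `∑ c_i X^(p^i)` of which it is a root. The result
consists of terms with the exponents `J + p^i I_j`, where `J` is an exponent of `c_i`, and the one
provided by `exists_unique_exponent` does not cancel. -/
theorem IsMonomialSystem.isApprox_of_charP (p : ℕ) [hp : Fact p.Prime] [CharP k p]
    (h : IsMonomialSystem k ν x w) {y : F}
    (hy : IsAlgebraic (IntermediateField.adjoin k (Set.range x)) y) : IsApprox k ν x y := by
  classical
  by_contra hyC
  have : CharP F p := charP_of_injective_algebraMap (algebraMap k F).injective p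
  obtain ⟨c, hc0, hc⟩ := exists_additive_relation p (Set.range x) hy
  have hlaurent : ∀ i, ∃ C : (Fin n → ℤ) →₀ k,
      ∑ J ∈ C.support, algebraMap k F (C J) * mon x J = c i :=
    fun i => mem_laurent_iff.1 (h.adjoin_le_laurent (c i).2)
  choose C hC using hlaurent
  obtain ⟨a, I, ha, hI, ⟨γ, hγ⟩, hrest⟩ := h.exists_expansion hyC
  set S : Finset (ℕ × (Fin n → ℤ)) :=
    c.support.biUnion fun i => (C i).support.image fun J => (i, J) with hS
  have hsumS : ∀ g : ℕ → F, ∑ i ∈ c.support, (c i : F) * g i =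
      ∑ s ∈ S, algebraMap k F (C s.1 s.2) * mon x s.2 * g s.1 := fun g => by
    rw [hS, Finset.sum_biUnion]
    · refine Finset.sum_congr rfl fun i _ => ?_
      rw [Finset.sum_image fun J _ J' _ e => (Prod.ext_iff.1 e).2, ← hC, Finset.sum_mul]
    · intro i _ i' _ hii'
      rw [Function.onFun, Finset.disjoint_left]
      intro s hs hs'
      obtain ⟨J, -, rfl⟩ := Finset.mem_image.1 hs
      obtain ⟨J', -, e⟩ := Finset.mem_image.1 hs'
      exact hii' (Prod.ext_iff.1 e).1.symm
  have hSne : S.Nonempty := by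
    obtain ⟨i, hi⟩ := Finsupp.support_nonempty_iff.2 hc0
    have : (C i).support.Nonempty := by
      rw [Finset.nonempty_iff_ne_empty]
      intro h0
      have := hC i
      rw [h0, Finset.sum_empty] at this
      exact Finsupp.mem_support_iff.1 hi (Subtype.ext this.symm)
    obtain ⟨J, hJ⟩ := this
    exact ⟨(i, J), Finset.mem_biUnion.2 ⟨i, hi, Finset.mem_image_of_mem _ hJ⟩⟩
  have hCS : ∀ s ∈ S, C s.1 s.2 ≠ 0 := fun s hs => by
    obtain ⟨i, -, hs⟩ := Finset.mem_biUnion.1 hs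
    obtain ⟨J, hJ, rfl⟩ := Finset.mem_image.1 hs
    exact Finsupp.mem_support_iff.1 hJ
  obtain ⟨s₀, hs₀, j₀, huniq, hless⟩ :=
    exists_unique_exponent hp.out.two_le h.inj hI hγ hSne
  -- a partial sum so long that the remainder contributes only terms of larger values
  have hev : ∀ᶠ m in atTop, ∀ s ∈ S,
      w (s₀.2 + p ^ s₀.1 • I j₀) < w s.2 + (p : ℝ) ^ s.1 * w (I m) := by
    rw [Filter.eventually_all_finset]
    intro s hs
    exact ((hγ.const_mul _).const_add _).eventually (lt_mem_nhds (hless s hs))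
  obtain ⟨m, hm, hj₀⟩ := (hev.and (eventually_gt_atTop j₀)).exists
  set Y : F := ∑ j ∈ Finset.range m, algebraMap k F (a j) * mon x (I j) with hY
  have hadd : ∑ i ∈ c.support, (c i : F) * Y ^ p ^ i =
      -∑ i ∈ c.support, (c i : F) * (y - Y) ^ p ^ i := by
    rw [eq_neg_iff_add_eq_zero, ← Finset.sum_add_distrib, ← hc]
    refine Finset.sum_congr rfl fun i _ => ?_
    rw [← mul_add, ← add_pow_char_pow, add_sub_cancel]
  have hright : (w (s₀.2 + p ^ s₀.1 • I j₀) : ℝ) <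
      ν (∑ i ∈ c.support, (c i : F) * (y - Y) ^ p ^ i) := by
    rw [hsumS]
    refine ν.map_lt_sum WithTop.coe_ne_top fun s hs => ?_
    rw [ν.map_mul, h.val_term (hCS s hs), ν.map_pow, hrest, ← WithTop.coe_nsmul,
      ← WithTop.coe_add, WithTop.coe_lt_coe, nsmul_eq_mul]
    simpa using hm s hs
  have hleft : ν (∑ i ∈ c.support, (c i : F) * Y ^ p ^ i) ≤
      (w (s₀.2 + p ^ s₀.1 • I j₀) : ℝ) := by
    have e : ∑ i ∈ c.support, (c i : F) * Y ^ p ^ i = ∑ t ∈ S ×ˢ Finset.range m,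
        algebraMap k F (C t.1.1 t.1.2 * a t.2 ^ p ^ t.1.1) *
          mon x (t.1.2 + p ^ t.1.1 • I t.2) := by
      rw [hsumS, Finset.sum_product]
      refine Finset.sum_congr rfl fun s _ => ?_
      rw [hY, sum_pow_char_pow, Finset.mul_sum]
      refine Finset.sum_congr rfl fun j _ => ?_
      rw [h.mon_add, h.mon_nsmul, map_mul, map_pow]
      ring
    rw [e]
    refine h.val_sum_le (S ×ˢ Finset.range m) (fun t => C t.1.1 t.1.2 * a t.2 ^ p ^ t.1.1)
      (fun t => t.1.2 + p ^ t.1.1 • I t.2) (t := (s₀, j₀))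
      (Finset.mem_product.2 ⟨hs₀, Finset.mem_range.2 hj₀⟩)
      (mul_ne_zero (hCS s₀ hs₀) (pow_ne_zero _ (ha j₀))) ?_
    intro t ht he
    obtain ⟨h1, h2⟩ := huniq t.1 (Finset.mem_product.1 ht).1 t.2 he
    exact Prod.ext h1 h2
  rw [hadd, ν.map_neg] at hleft
  exact absurd hright (not_lt.2 hleft)

end CharP

/-! ### Topology of valued fields -/

section Valued

open Filter Topology Valuation

variable {L : Type*} [Field L] {Γ₀ : Type*} [LinearOrderedCommGroupWithZero Γ₀] [Valued L Γ₀]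

lemma valued_mem_nhds_zero {U : Set L} :
    U ∈ 𝓝 (0 : L) ↔ ∃ z₀ : L, z₀ ≠ 0 ∧ {z | Valued.v z < Valued.v z₀} ⊆ U := by
  rw [Valued.mem_nhds_zero]
  constructor
  · rintro ⟨γ, hγ⟩
    obtain ⟨r, s, hr, hs, hrs⟩ := restrict_exists_div_eq Valued.v γ
    rw [Valuation.pos_iff] at hr hs
    refine ⟨r / s, div_ne_zero hr hs, fun z hz => hγ ?_⟩
    rw [Set.mem_ofPred_eq, ← hrs, ← map_div₀, restrict_lt_iff]
    exact hz
  · rintro ⟨z₀, hz₀, h⟩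
    have h0 : Valued.v.restrict z₀ ≠ 0 := by simpa using hz₀
    refine ⟨Units.mk0 _ h0, fun z hz => h ?_⟩
    rw [Set.mem_ofPred_eq, Units.val_mk0, restrict_lt_iff] at hz
    exact hz

lemma isOpen_valued_lt (z₀ : L) : IsOpen {z : L | Valued.v z < Valued.v z₀} := by
  simpa only [restrict_lt_iff] using Valued.isOpen_ball L (Valued.v.restrict z₀)

lemma isClosed_valued_lt (z₀ : L) : IsClosed {z : L | Valued.v z < Valued.v z₀} := by
  simpa only [restrict_lt_iff] using Valued.isClosed_ball L (Valued.v.restrict z₀)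

lemma isClosed_valued_le (z₀ : L) : IsClosed {z : L | Valued.v z ≤ Valued.v z₀} := by
  simpa only [restrict_le_iff] using Valued.isClosed_closedBall L (Valued.v.restrict z₀)

lemma valued_nonarchimedeanRing : NonarchimedeanRing L where
  is_nonarchimedean U hU := by
    obtain ⟨z₀, hz₀, h⟩ := valued_mem_nhds_zero.1 hU
    have h0 : Valued.v z₀ ≠ 0 := by simpa using hz₀
    exact ⟨⟨Valued.v.ltAddSubgroup (Units.mk0 _ h0), isOpen_valued_lt z₀⟩, h⟩

lemma valued_hasSum_lt {ι : Type*} {f : ι → L} {s : L} (hf : HasSum f s) {z₀ : L} (hz₀ : z₀ ≠ 0)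
    (h : ∀ i, Valued.v (f i) < Valued.v z₀) : Valued.v s < Valued.v z₀ :=
  (isClosed_valued_lt z₀).mem_of_tendsto hf <| Eventually.of_forall fun _ =>
    Valued.v.map_sum_lt (by simpa using hz₀) fun i _ => h i

lemma valued_hasSum_le {ι : Type*} {f : ι → L} {s : L} (hf : HasSum f s) {z₀ : L}
    (h : ∀ i, Valued.v (f i) ≤ Valued.v z₀) : Valued.v s ≤ Valued.v z₀ :=
  (isClosed_valued_le z₀).mem_of_tendsto hf <| Eventually.of_forall fun _ =>
    Valued.v.map_sum_le fun i _ => h i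

/-- A ring isomorphism of valued fields which preserves the valuation is a homeomorphism. -/
lemma isHomeomorph_of_valued {L' : Type*} [Field L'] [Valued L' Γ₀] (e : L ≃+* L')
    (he : ∀ z, Valued.v (e z) = Valued.v z) : IsHomeomorph e := by
  have hc : Continuous e := by
    refine continuous_of_continuousAt_zero e fun U hU => ?_
    rw [map_zero] at hU
    obtain ⟨z₀, hz₀, h⟩ := valued_mem_nhds_zero.1 hU
    refine valued_mem_nhds_zero.2 ⟨e.symm z₀, by simpa using hz₀, fun z hz => h ?_⟩
    rw [Set.mem_ofPred_eq, ← he z, ← he (e.symm z₀), e.apply_symm_apply] at hz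
    exact hz
  have hc' : Continuous e.symm := by
    refine continuous_of_continuousAt_zero e.symm fun U hU => ?_
    rw [map_zero] at hU
    obtain ⟨z₀, hz₀, h⟩ := valued_mem_nhds_zero.1 hU
    refine valued_mem_nhds_zero.2 ⟨e z₀, by simpa using hz₀, fun z hz => h ?_⟩
    rw [Set.mem_ofPred_eq, he] at hz
    rw [Set.mem_ofPred_eq, ← he (e.symm z), e.apply_symm_apply]
    exact hz
  exact (Homeomorph.mk e.toEquiv hc hc').isHomeomorph

end Valued

section Completion

open Filter Topology

variable {E : Type*} [Field E] {Γ₀ : Type*} [LinearOrderedCommGroupWithZero Γ₀]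

/-- The canonical map from a field to its completion, as a ring homomorphism. -/
def toCompletionHom (v : Valuation E Γ₀) : E →+* v.Completion :=
  UniformSpace.Completion.coeRingHom.comp (WithVal.equiv v).symm.toRingHom

lemma valued_toCompletionHom (v : Valuation E Γ₀) (y : E) :
    Valued.v (toCompletionHom v y) = v y :=
  Valued.valuedCompletion_apply (WithVal.toVal v y)

lemma exists_valued_eq (v : Valuation E Γ₀) (z : v.Completion) :
    ∃ y : E, Valued.v z = v y := by
  obtain ⟨r, hr⟩ := Valued.exists_coe_eq_v (K := WithVal v) z
  exact ⟨r.ofVal, hr⟩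

lemma exists_valued_sub_lt (v : Valuation E Γ₀) (z : v.Completion) {e : E} (he : e ≠ 0) :
    ∃ y : E, Valued.v (z - toCompletionHom v y) < v e := by
  have hU : {z' : v.Completion | Valued.v (z - z') < v e} ∈ 𝓝 z := by
    have h0 : {z' : v.Completion | Valued.v z' < v e} ∈ 𝓝 (0 : v.Completion) :=
      valued_mem_nhds_zero.2 ⟨toCompletionHom v e, by simpa using he, by
        simp only [valued_toCompletionHom]; exact subset_rfl⟩
    have hc : Tendsto (fun z' => z - z') (𝓝 z) (𝓝 0) := by
      have : Continuous fun z' : v.Completion => z - z' := by fun_prop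
      simpa using this.tendsto z
    exact hc h0
  obtain ⟨y, hy⟩ := UniformSpace.Completion.denseRange_coe.mem_nhds hU
  exact ⟨y.ofVal, hy⟩

end Completion

/-! ### Series in the completion -/

section Series

open Filter Topology IsMonomialSystem

variable {k E : Type*} [Field k] [Field E] [Algebra k E] {Γ₀ : Type*}
  [LinearOrderedCommGroupWithZero Γ₀] {n : ℕ}

/-- The term `a_I x^I` of a formal sum, as an element of the completion. -/
def term (v : Valuation E Γ₀) (x : Fin n → E) (a : (Fin n → ℤ) → k) (I : Fin n → ℤ) :
    v.Completion :=
  toCompletionHom v (algebraMap k E (a I) * mon x I)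

variable {v : Valuation E Γ₀} {ν : AddValuation E (WithTop ℝ)} {x : Fin n → E}
  {w : (Fin n → ℤ) →+ ℝ}

lemma valued_term_lt (h : IsMonomialSystem k ν x w) (hv : ∀ y z, v y ≤ v z ↔ ν z ≤ ν y)
    {a : (Fin n → ℤ) → k} {I : Fin n → ℤ} {z : E} (hz : z ≠ 0)
    (ha : a I ≠ 0 → ν z < (w I : ℝ)) : Valued.v (term v x a I) < v z := by
  rw [term, valued_toCompletionHom, ← not_le, hv, not_le]
  by_cases h0 : a I = 0
  · rw [h0, map_zero, zero_mul, ν.map_zero]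
    exact lt_top_iff_ne_top.2 (ν.ne_top_iff.2 hz)
  · rw [h.val_term h0]
    exact ha h0

lemma valued_term_le (h : IsMonomialSystem k ν x w) (hv : ∀ y z, v y ≤ v z ↔ ν z ≤ ν y)
    {a : (Fin n → ℤ) → k} {I : Fin n → ℤ} {z : E}
    (ha : a I ≠ 0 → ν z ≤ (w I : ℝ)) : Valued.v (term v x a I) ≤ v z := by
  rw [term, valued_toCompletionHom, hv]
  by_cases h0 : a I = 0
  · simp [h0]
  · rw [h.val_term h0]
    exact ha h0

lemma term_sub (a b : (Fin n → ℤ) → k) (I : Fin n → ℤ) :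
    term v x (fun J => a J - b J) I = term v x a I - term v x b I := by
  simp only [term, ← map_sub, ← sub_mul]

lemma hasSum_term_finsupp (L : (Fin n → ℤ) →₀ k) :
    HasSum (term v x L)
      (toCompletionHom v (∑ I ∈ L.support, algebraMap k E (L I) * mon x I)) := by
  rw [map_sum]
  refine hasSum_sum_of_ne_finset_zero (f := term v x L) fun I hI => ?_
  rw [term, Finsupp.notMem_support_iff.1 hI]
  simp

/-- A formal sum with finitely many terms below every bound converges in the completion. -/
lemma summable_term (h : IsMonomialSystem k ν x w) (hv : ∀ y z, v y ≤ v z ↔ ν z ≤ ν y)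
    {a : (Fin n → ℤ) → k} (ha : ∀ c : ℝ, {I | a I ≠ 0 ∧ w I < c}.Finite) :
    Summable (term v x a) := by
  have := valued_nonarchimedeanRing (L := v.Completion)
  refine NonarchimedeanAddGroup.summable_of_tendsto_cofinite_zero fun U hU => ?_
  obtain ⟨z₀, hz₀, hU⟩ := valued_mem_nhds_zero.1 hU
  obtain ⟨y, hy⟩ := exists_valued_eq v z₀
  have hy0 : y ≠ 0 := by
    rintro rfl
    rw [map_zero] at hy
    exact hz₀ ((Valuation.zero_iff _).1 hy)
  obtain ⟨c, hc⟩ := WithTop.ne_top_iff_exists.1 (ν.ne_top_iff.2 hy0)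
  refine (ha (c + 1)).subset fun I hI => ?_
  by_contra hcon
  refine hI (hU ?_)
  rw [Set.mem_ofPred_eq, hy]
  refine valued_term_lt h hv hy0 fun h0 => ?_
  have : ¬ w I < c + 1 := fun hlt => hcon ⟨h0, hlt⟩
  rw [← hc, WithTop.coe_lt_coe]
  linarith

/-- The valuation of a sum is that of its dominant term. -/
lemma valued_hasSum_term (h : IsMonomialSystem k ν x w) (hv : ∀ y z, v y ≤ v z ↔ ν z ≤ ν y)
    {a : (Fin n → ℤ) → k} {s : v.Completion} (hs : HasSum (term v x a) s) {I : Fin n → ℤ}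
    (hI : a I ≠ 0) (hmin : ∀ J, a J ≠ 0 → w I ≤ w J) : Valued.v s = v (mon x I) := by
  classical
  have hterm : Valued.v (term v x a I) = v (mon x I) := by
    rw [term, valued_toCompletionHom]
    refine le_antisymm ?_ ?_ <;> rw [hv, h.val_term hI, h.val]
  have hlt : Valued.v (s - term v x a I) < Valued.v (toCompletionHom v (mon x I)) := by
    refine valued_hasSum_lt (hasSum_ite_sub_hasSum hs I)
      (by simpa using h.mon_ne_zero I) fun J => ?_
    rw [valued_toCompletionHom]
    split_ifs with hJ
    · rw [map_zero]
      exact (Valuation.pos_iff v).2 (h.mon_ne_zero I)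
    · refine valued_term_lt h hv (h.mon_ne_zero I) fun h0 => ?_
      rw [h.val, WithTop.coe_lt_coe]
      exact (hmin J h0).lt_of_ne fun e => hJ (h.inj e).symm
  rw [valued_toCompletionHom, ← hterm] at hlt
  rw [← hterm]
  exact Valuation.map_eq_of_sub_lt _ hlt

/-- If the Laurent polynomials are dense, then every element of the completion is the sum of a
series. Its coefficients are the eventual coefficients of a sequence of Laurent polynomials
converging to the given element. -/
theorem exists_series (h : IsMonomialSystem k ν x w) (hv : ∀ y z, v y ≤ v z ↔ ν z ≤ ν y)
    (hw : w ≠ 0) (hdense : ∀ y, IsApprox k ν x y) (z : v.Completion) :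
    ∃ a : (Fin n → ℤ) → k, (∀ c : ℝ, {I | a I ≠ 0 ∧ w I < c}.Finite) ∧
      HasSum (term v x a) z := by
  classical
  obtain ⟨T, hT⟩ : ∃ T, 0 < w T := by
    obtain ⟨T, hT⟩ := DFunLike.ne_iff.1 hw
    rcases lt_or_gt_of_ne hT with h | h
    · exact ⟨-T, by rw [map_neg]; simpa using h⟩
    · exact ⟨T, h⟩
  set δ : ℝ := w T with hδ
  have hval : ∀ m : ℕ, ν (mon x (m • T)) = ((m * δ : ℝ) : WithTop ℝ) := fun m => by
    rw [h.val, map_nsmul, nsmul_eq_mul]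
  have happrox : ∀ m : ℕ, ∃ L : (Fin n → ℤ) →₀ k,
      Valued.v (z - toCompletionHom v (∑ I ∈ L.support, algebraMap k E (L I) * mon x I)) ≤
        v (mon x (m • T)) := fun m => by
    obtain ⟨y, hy⟩ := exists_valued_sub_lt v z (h.mon_ne_zero (m • T))
    obtain ⟨l, hl, hyl⟩ := hdense y (m * δ)
    obtain ⟨L, rfl⟩ := mem_laurent_iff.1 hl
    refine ⟨L, ?_⟩
    rw [← sub_add_sub_cancel z (toCompletionHom v y)]
    refine Valuation.map_add_le _ hy.le ?_
    rw [← map_sub, valued_toCompletionHom, hv, hval]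
    exact hyl
  choose L hL using happrox
  have hval_le : ∀ {m m' : ℕ}, m ≤ m' → v (mon x (m' • T)) ≤ v (mon x (m • T)) :=
    fun {m m'} hm => by
      rw [hv, hval, hval, WithTop.coe_le_coe]
      have : (m : ℝ) ≤ m' := by exact_mod_cast hm
      nlinarith
  have hagree : ∀ (m m' : ℕ) (I : Fin n → ℤ), m ≤ m' → w I < m * δ → L m I = L m' I := by
    intro m m' I hm hI
    by_contra hne
    have h1 : Valued.v (toCompletionHom v (∑ J ∈ (L m).support, algebraMap k E (L m J) * mon x J) -
        toCompletionHom v (∑ J ∈ (L m').support, algebraMap k E (L m' J) * mon x J)) ≤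
          v (mon x (m • T)) := by
      rw [← sub_sub_sub_cancel_left _ _ z]
      exact Valuation.map_sub_le _ ((hL m').trans (hval_le hm)) (hL m)
    rw [← map_sub, valued_toCompletionHom, hv, hval] at h1
    have e : ∀ j, (L j).support ⊆ (L m).support ∪ (L m').support →
        ∑ J ∈ (L j).support, algebraMap k E (L j J) * mon x J =
        ∑ J ∈ (L m).support ∪ (L m').support, algebraMap k E (L j J) * mon x J := fun j hj =>
      Finset.sum_subset hj fun J _ hJ => by simp [Finsupp.notMem_support_iff.1 hJ]
    rw [e m Finset.subset_union_left, e m' Finset.subset_union_right,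
      ← Finset.sum_sub_distrib] at h1
    simp only [← sub_mul, ← map_sub] at h1
    have hIS : I ∈ (L m).support ∪ (L m').support := by
      by_contra hI'
      rw [Finset.mem_union, not_or, Finsupp.notMem_support_iff,
        Finsupp.notMem_support_iff] at hI'
      exact hne (hI'.1.trans hI'.2.symm)
    have h2 := h.val_sum_le_of_distinct _ (fun J => L m J - L m' J) hIS (sub_ne_zero.2 hne)
    have h3 := h1.trans h2
    rw [WithTop.coe_le_coe] at h3
    exact absurd hI (not_lt.2 h3)
  have hN : ∀ c : ℝ, ∃ N : ℕ, c < N * δ := fun c => by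
    obtain ⟨N, hN⟩ := exists_nat_gt (c / δ)
    exact ⟨N, (div_lt_iff₀ hT).1 hN⟩
  choose N hN using hN
  set a : (Fin n → ℤ) → k := fun I => L (N (w I)) I with ha
  have haL : ∀ (m : ℕ) (I : Fin n → ℤ), w I < m * δ → a I = L m I := fun m I hI => by
    rcases le_total m (N (w I)) with hle | hle
    · exact (hagree _ _ I hle hI).symm
    · exact hagree _ _ I hle (hN _)
  have hfin : ∀ c : ℝ, {I | a I ≠ 0 ∧ w I < c}.Finite := fun c => by
    refine (L (N c)).support.finite_toSet.subset fun I hI => ?_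
    rw [Finset.mem_coe, Finsupp.mem_support_iff, ← haL _ _ (hI.2.trans (hN c))]
    exact hI.1
  refine ⟨a, hfin, ?_⟩
  obtain ⟨s, hs⟩ := summable_term h hv hfin
  have hclose : ∀ m : ℕ, Valued.v (z - s) ≤ v (mon x (m • T)) := fun m => by
    have h1 := hs.sub (hasSum_term_finsupp (v := v) (x := x) (L m))
    simp only [← term_sub] at h1
    rw [← valued_toCompletionHom v (mon x (m • T)), ← sub_sub_sub_cancel_right z s
      (toCompletionHom v (∑ I ∈ (L m).support, algebraMap k E (L m I) * mon x I))]
    refine Valuation.map_sub_le _ ?_ (valued_hasSum_le h1 fun I => ?_)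
    · rw [valued_toCompletionHom]; exact hL m
    · rw [valued_toCompletionHom]
      refine valued_term_le h hv fun h0 => ?_
      rw [hval, WithTop.coe_le_coe]
      by_contra hlt
      exact h0 (sub_eq_zero.2 (haL m I (not_le.1 hlt)))
  obtain ⟨r, hr⟩ := exists_valued_eq v (z - s)
  have hr0 : r = 0 := by
    by_contra hr0
    obtain ⟨c, hc⟩ := WithTop.ne_top_iff_exists.1 (ν.ne_top_iff.2 hr0)
    have h1 := hclose (N c)
    rw [hr, hv, hval, ← hc, WithTop.coe_le_coe] at h1
    exact absurd (hN c) (not_lt.2 h1)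
  have hzs : z = s := by
    rw [hr0, map_zero, Valuation.zero_iff, sub_eq_zero] at hr
    exact hr
  rwa [hzs]

end Series

/-! ### The ring of formal sums -/

section FormalSums

open Filter Topology IsMonomialSystem

variable {k E : Type*} [Field k] [Field E] [Algebra k E] {Γ₀ : Type*}
  [LinearOrderedCommGroupWithZero Γ₀] {n : ℕ}

/-- The weight of an exponent, as a homomorphism on `ℤⁿ`. -/
def weightHom (u : Fin n → ℝ) : (Fin n → ℤ) →+ ℝ := weight u

lemma FormalSums.finite {u : Fin n → ℝ} (a : FormalSums k u) (c : ℝ) :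
    {I : Fin n → ℤ | a.coeff I ≠ 0 ∧ weightHom u I < c}.Finite := a.2 c

lemma FormalSums.exists_min {u : Fin n → ℝ} {a : FormalSums k u} (ha : a ≠ 0) :
    ∃ I, a.coeff I ≠ 0 ∧ ∀ J, a.coeff J ≠ 0 → weightHom u I ≤ weightHom u J := by
  obtain ⟨J, hJ⟩ : ∃ J, a.coeff J ≠ 0 := by
    by_contra hc
    push Not at hc
    exact ha (Subtype.ext (HahnSeries.ext (funext hc)))
  obtain ⟨I, hI, hmin⟩ := (a.finite (weightHom u J + 1)).exists_minimalFor (weightHom u) _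
    ⟨J, hJ, lt_add_one _⟩
  refine ⟨I, hI.1, fun K hK => ?_⟩
  by_contra hlt
  rw [not_le] at hlt
  exact absurd (hmin ⟨hK, hlt.trans hI.2⟩ hlt.le) (not_le.2 hlt)

variable {v : Valuation E Γ₀} {ν : AddValuation E (WithTop ℝ)} {x : Fin n → E}
  {u : Fin n → ℝ}

/-- The Cauchy product of two convergent series. -/
lemma hasSum_term_mul (h : IsMonomialSystem k ν x (weightHom u))
    {a b : FormalSums k u} {s t : v.Completion} (hs : HasSum (term v x a.coeff) s)
    (ht : HasSum (term v x b.coeff) t) : HasSum (term v x (a * b).coeff) (s * t) := by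
  classical
  have := valued_nonarchimedeanRing (L := v.Completion)
  have hst := hs.mul_of_nonarchimedean ht
  -- the pairs `(K - J, J)`, sorted by their sum `K`
  let σ : (Fin n → ℤ) × (Fin n → ℤ) ≃ (Fin n → ℤ) × (Fin n → ℤ) :=
    { toFun := fun q => (q.1 - q.2, q.2)
      invFun := fun q => (q.1 + q.2, q.2)
      left_inv := fun q => by simp
      right_inv := fun q => by simp }
  refine HasSum.prod_fiberwise (σ.hasSum_iff.2 hst) fun K => ?_
  set A : Finset ((Fin n → ℤ) × (Fin n → ℤ)) :=
    Finset.antidiagonal (α := Exponent u) a.1.isPWO_support b.1.isPWO_support K with hA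
  have hmemA : ∀ q : (Fin n → ℤ) × (Fin n → ℤ),
      q ∈ A ↔ a.coeff q.1 ≠ 0 ∧ b.coeff q.2 ≠ 0 ∧ q.1 + q.2 = K := fun q => by
    rw [hA]
    exact Finset.mem_antidiagonal
  have hcoeff : (a * b).coeff K = ∑ q ∈ A, a.coeff q.1 * b.coeff q.2 :=
    HahnSeries.coeff_mul (x := a.1) (y := b.1)
  have hsum : term v x (a * b).coeff K =
      ∑ J ∈ A.image Prod.snd, term v x a.coeff (K - J) * term v x b.coeff J := by
    rw [Finset.sum_image]
    · rw [term, hcoeff, map_sum, Finset.sum_mul, map_sum]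
      refine Finset.sum_congr rfl fun q hq => ?_
      have hK : K - q.2 = q.1 := by rw [← ((hmemA q).1 hq).2.2, add_sub_cancel_right]
      rw [hK, term, term, ← map_mul]
      refine congrArg _ ?_
      rw [← ((hmemA q).1 hq).2.2, h.mon_add, map_mul]
      ring
    · intro q hq q' hq' e
      refine Prod.ext ?_ e
      have h1 := ((hmemA q).1 hq).2.2
      have h2 := ((hmemA q').1 hq').2.2
      rw [← h2, e] at h1
      exact add_right_cancel h1
  rw [hsum]
  refine hasSum_sum_of_ne_finset_zero fun J hJ => ?_
  change term v x a.coeff (K - J) * term v x b.coeff J = 0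
  by_cases hb : b.coeff J = 0
  · simp [term, hb]
  · by_cases ha : a.coeff (K - J) = 0
    · simp [term, ha]
    · exact absurd (Finset.mem_image.2 ⟨(K - J, J), (hmemA _).2 ⟨ha, hb, by simp⟩, rfl⟩) hJ

/-- If the Laurent polynomials are dense, then the completion is the ring of formal sums. -/
theorem exists_formalSums_equiv (h : IsMonomialSystem k ν x (weightHom u))
    (hv : ∀ y z, v y ≤ v z ↔ ν z ≤ ν y) (hw : weightHom u ≠ 0)
    (hdense : ∀ y, IsApprox k ν x y) :
    ∃ φ : FormalSums k u ≃+* v.Completion, ∀ a, HasSum (term v x a.coeff) (φ a) := by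
  classical
  have hsum : ∀ a : FormalSums k u, HasSum (term v x a.coeff) (∑' I, term v x a.coeff I) :=
    fun a => (summable_term h hv a.finite).hasSum
  let φ : FormalSums k u →+* v.Completion :=
    { toFun := fun a => ∑' I, term v x a.coeff I
      map_zero' := by
        refine HasSum.tsum_eq (HasSum.congr_fun hasSum_zero fun I => ?_)
        change term v x (fun _ => 0) I = 0
        simp [term]
      map_one' := by
        have h1 : ∀ I, (1 : FormalSums k u).coeff I = if I = 0 then 1 else 0 :=
          fun I => (HahnSeries.coeff_one (Γ := Exponent u)).trans (by congr)
        refine HasSum.tsum_eq ?_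
        convert hasSum_single (f := term v x (1 : FormalSums k u).coeff) 0 fun I hI => ?_
        · rw [term, h1]; simp [mon_zero]
        · rw [term, h1]; simp [hI]
      map_add' := fun a b => by
        refine HasSum.tsum_eq (HasSum.congr_fun ((hsum a).add (hsum b)) fun I => ?_)
        change term v x (fun J => a.coeff J + b.coeff J) I = _
        simp only [term, ← map_add, ← add_mul]
      map_mul' := fun a b => (hasSum_term_mul h (hsum a) (hsum b)).tsum_eq }
  have hinj : Function.Injective φ := by
    rw [injective_iff_map_eq_zero]
    intro a ha
    by_contra ha0
    obtain ⟨I, hI, hmin⟩ := FormalSums.exists_min ha0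
    have h1 := valued_hasSum_term h hv (hsum a) hI hmin
    change Valued.v (φ a) = _ at h1
    rw [ha, map_zero] at h1
    exact h.mon_ne_zero I ((Valuation.zero_iff _).1 h1.symm)
  have hsurj : Function.Surjective φ := fun z => by
    obtain ⟨a, ha, hz⟩ := exists_series h hv hw hdense z
    exact ⟨FormalSums.mk (w := u) a ha, (hsum _).unique hz⟩
  exact ⟨RingEquiv.ofBijective φ ⟨hinj, hsurj⟩, hsum⟩

end FormalSums

/-! ### Monomial valuations -/

section LogValuation

variable {F : Type*} [Field F] {Γ₀ : Type*} [LinearOrderedCommGroupWithZero Γ₀]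
  (v : Valuation F Γ₀) [v.RankOne]

/-- The absolute value of a rank one valuation, as a homomorphism to the real numbers. -/
def absHom : F →*₀ ℝ :=
  NNReal.toRealHom.toMonoidWithZeroHom.comp
    ((Valuation.RankOne.hom v).comp v.restrict.toMonoidWithZeroHom)

lemma realValue_eq (y : F) : realValue v y = -Real.log (absHom v y) := rfl

lemma absHom_le_iff (y z : F) : absHom v y ≤ absHom v z ↔ v y ≤ v z := by
  change ((Valuation.RankOne.hom v (v.restrict y) : ℝ≥0) : ℝ) ≤
    (Valuation.RankOne.hom v (v.restrict z) : ℝ≥0) ↔ _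
  rw [NNReal.coe_le_coe, (Valuation.RankOne.strictMono v).le_iff_le, v.restrict_le_iff]

lemma absHom_pos {y : F} (hy : y ≠ 0) : 0 < absHom v y :=
  lt_of_le_of_ne (NNReal.coe_nonneg _) ((map_ne_zero (absHom v)).2 hy).symm

lemma realValue_mul {y z : F} (hy : y ≠ 0) (hz : z ≠ 0) :
    realValue v (y * z) = realValue v y + realValue v z := by
  rw [realValue_eq, map_mul, Real.log_mul (absHom_pos v hy).ne' (absHom_pos v hz).ne', neg_add]
  rfl

lemma realValue_le_iff {y z : F} (hy : y ≠ 0) (hz : z ≠ 0) :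
    realValue v z ≤ realValue v y ↔ v y ≤ v z := by
  rw [realValue_eq, realValue_eq, neg_le_neg_iff,
    Real.log_le_log_iff (absHom_pos v hy) (absHom_pos v hz), absHom_le_iff]

open Classical in
/-- The values of a rank one valuation in additive notation, including `+∞`. -/
def logValue (y : F) : WithTop ℝ := if y = 0 then ⊤ else (realValue v y : ℝ)

lemma logValue_of_ne_zero {y : F} (hy : y ≠ 0) : logValue v y = (realValue v y : ℝ) :=
  if_neg hy

lemma logValue_le_iff (y z : F) : logValue v z ≤ logValue v y ↔ v y ≤ v z := by
  by_cases hy : y = 0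
  · simp [hy, logValue]
  by_cases hz : z = 0
  · simp [hy, hz, logValue]
  rw [logValue_of_ne_zero v hy, logValue_of_ne_zero v hz, WithTop.coe_le_coe,
    realValue_le_iff v hy hz]

/-- A rank one valuation in additive notation. -/
def logValuation : AddValuation F (WithTop ℝ) :=
  AddValuation.of (logValue v) (if_pos rfl)
    (by rw [logValue_of_ne_zero v one_ne_zero, realValue_eq]; simp)
    (fun y z => by
      rcases le_total (v y) (v z) with h | h
      · refine (min_le_right _ _).trans ((logValue_le_iff v _ _).2 ?_)
        exact v.map_add_le h le_rfl
      · refine (min_le_left _ _).trans ((logValue_le_iff v _ _).2 ?_)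
        exact v.map_add_le le_rfl h)
    (fun y z => by
      by_cases hy : y = 0
      · simp [hy, logValue]
      by_cases hz : z = 0
      · simp [hz, logValue]
      rw [logValue_of_ne_zero v hy, logValue_of_ne_zero v hz,
        logValue_of_ne_zero v (mul_ne_zero hy hz), realValue_mul v hy hz, WithTop.coe_add])

lemma logValuation_of_ne_zero {y : F} (hy : y ≠ 0) :
    logValuation v y = (realValue v y : ℝ) := logValue_of_ne_zero v hy

lemma logValuation_le_iff (y z : F) : v y ≤ v z ↔ logValuation v z ≤ logValuation v y :=
  (logValue_le_iff v y z).symm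

lemma logValuation_lt_iff (y z : F) : v y < v z ↔ logValuation v z < logValuation v y := by
  rw [← not_le, ← not_le, logValuation_le_iff]

lemma realValue_mon {n : ℕ} {x : Fin n → F} (hx : ∀ i, x i ≠ 0) (I : Fin n → ℤ) :
    realValue v (mon x I) = weightHom (fun i => realValue v (x i)) I := by
  rw [realValue_eq, mon, map_prod,
    Real.log_prod fun i _ => (absHom_pos v (zpow_ne_zero _ (hx i))).ne', ← Finset.sum_neg_distrib]
  refine Finset.sum_congr rfl fun i _ => ?_
  rw [map_zpow₀, Real.log_zpow, ← mul_neg]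
  rfl

end LogValuation

section Monomial

variable {k F : Type*} [Field k] [Field F] [Algebra k F] {Γ₀ : Type*}
  [LinearOrderedCommGroupWithZero Γ₀] {v : Valuation F Γ₀} {n : ℕ} {x : Fin n → F}

lemma FreelyGenerate.ne_zero (hx : FreelyGenerate v x) (i : Fin n) : x i ≠ 0 := by
  obtain ⟨b, hb⟩ := hx
  rw [← v.ne_zero_iff, ← hb i]
  exact Units.ne_zero _

lemma coe_valueGroup_sum (b : Fin n → ValueGroup v)
    (hb : ∀ i, (((b i).toMul : Γ₀ˣ) : Γ₀) = v (x i)) (I : Fin n → ℤ) :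
    ((((∑ i, I i • b i).toMul : Γ₀ˣ)) : Γ₀) = v (mon x I) := by
  rw [toMul_sum, mon, map_prod]
  simp [hb]

lemma FreelyGenerate.eq_zero (hx : FreelyGenerate v x) {I : Fin n → ℤ}
    (hI : v (mon x I) = 1) : I = 0 := by
  obtain ⟨b, hb⟩ := hx
  rw [← coe_valueGroup_sum b hb] at hI
  have h0 : ∑ i, I i • b i = 0 := by
    apply Additive.toMul.injective
    apply Subtype.ext
    exact Units.ext hI
  funext i
  exact Fintype.linearIndependent_iff.1 b.linearIndependent I h0 i

lemma FreelyGenerate.exists_eq (hx : FreelyGenerate v x) {y : F} (hy : y ≠ 0) :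
    ∃ I, v (mon x I) = v y := by
  obtain ⟨b, hb⟩ := hx
  have hvy : v y ≠ 0 := v.ne_zero_iff.2 hy
  let g : ValueGroup v := Additive.ofMul
    ⟨Units.mk0 (v y) hvy, MonoidWithZeroHom.mem_valueGroup _ ⟨y, rfl⟩⟩
  refine ⟨fun i => b.repr g i, ?_⟩
  rw [← coe_valueGroup_sum b hb, b.sum_repr]
  rfl

/-- If the residue field of `v` is `k`, then every element of value one is congruent to a
constant. -/
lemma IsMonomial.exists_residue (hv : IsMonomial k v) {y : F} (hy : v y = 1) :
    ∃ a : k, v (y - algebraMap k F a) < 1 := by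
  obtain ⟨a, ha⟩ := hv.residueField_eq.2
    (IsLocalRing.residue v.valuationSubring ⟨y, (v.mem_valuationSubring_iff y).2 hy.le⟩)
  refine ⟨a, ?_⟩
  rw [coeffToResidueField, RingHom.comp_apply, ← sub_eq_zero, ← map_sub,
    IsLocalRing.residue_eq_zero_iff, Valuation.mem_maximalIdeal_iff] at ha
  rw [v.map_sub_swap]
  exact ha

/-- A monomial valuation, together with elements whose values form a basis of the value group,
satisfies the axioms of `IsMonomialSystem`. -/
lemma IsMonomial.isMonomialSystem [v.RankOne] (hv : IsMonomial k v) (hx : FreelyGenerate v x) :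
    IsMonomialSystem k (logValuation v) x (weightHom fun i => realValue v (x i)) := by
  have hmon : ∀ I, mon x I ≠ 0 := fun I =>
    Finset.prod_ne_zero_iff.2 fun i _ => zpow_ne_zero _ (hx.ne_zero i)
  have hone : ∀ y : F, v y = 1 ↔ logValuation v y = 0 := fun y => by
    rw [← v.map_one, ← (logValuation v).map_one, le_antisymm_iff, le_antisymm_iff,
      logValuation_le_iff, logValuation_le_iff]
    exact and_comm
  have hval : ∀ I, logValuation v (mon x I) = (weightHom (fun i => realValue v (x i)) I : ℝ) :=
    fun I => by rw [logValuation_of_ne_zero v (hmon I), realValue_mon v hx.ne_zero]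
  refine ⟨fun c hc => ?_, ?_, hval, fun y hy => ?_⟩
  · rw [← hone]
    exact hv.isTrivialOn.eq_one c hc
  · rw [injective_iff_map_eq_zero]
    intro I hI
    refine hx.eq_zero ((hone _).2 ?_)
    rw [hval, hI, WithTop.coe_zero]
  · obtain ⟨I, hI⟩ := hx.exists_eq hy
    have h1 : v (y / mon x I) = 1 := by
      rw [map_div₀, hI, div_self (v.ne_zero_iff.2 hy)]
    obtain ⟨a, ha⟩ := hv.exists_residue h1
    refine ⟨a, I, (logValuation_lt_iff v _ _).1 ?_⟩
    have e : y - algebraMap k F a * mon x I = (y / mon x I - algebraMap k F a) * mon x I := by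
      rw [sub_mul, div_mul_cancel₀ _ (hmon I)]
    rw [e, map_mul, hI]
    exact mul_lt_of_lt_one_left (zero_lt_iff.2 (v.ne_zero_iff.2 hy)) ha

namespace IsMonomialSystem

variable {ν : AddValuation F (WithTop ℝ)} {w : (Fin n → ℤ) →+ ℝ}

/-- Elements whose monomials have different values are algebraically independent. -/
lemma algebraicIndependent (h : IsMonomialSystem k ν x w) : AlgebraicIndependent k x := by
  rw [algebraicIndependent_iff]
  intro P hP
  by_contra hP0
  obtain ⟨d, hd⟩ := MvPolynomial.ne_zero_iff.1 hP0
  have e : MvPolynomial.aeval x P = ∑ d ∈ P.support,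
      algebraMap k F (P.coeff d) * mon x (fun i => (d i : ℤ)) := by
    rw [MvPolynomial.aeval_def, MvPolynomial.eval₂_eq']
    simp [mon]
  have h1 := h.val_sum_le P.support (fun d => P.coeff d) (fun d i => (d i : ℤ))
    (MvPolynomial.mem_support_iff.2 hd) hd fun d' _ he => by
      ext i
      exact_mod_cast congrFun he i
  rw [← e, hP, ν.map_zero] at h1
  exact absurd h1 (not_le.2 (WithTop.coe_lt_top _))

/-- Elements which are algebraic over the field generated by the `x i` are limits of Laurent
polynomials. -/
theorem isApprox_of_isAlgebraic (h : IsMonomialSystem k ν x w) {y : F}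
    (hy : IsAlgebraic (IntermediateField.adjoin k (Set.range x)) y) : IsApprox k ν x y := by
  rcases CharP.exists' k with h0 | ⟨p, hp, hchar⟩
  · have hle : IntermediateField.adjoin k (Set.range x) ≤ h.closureField := by
      rw [IntermediateField.adjoin_le_iff]
      rintro _ ⟨i, rfl⟩
      exact isApprox_of_mem
        (h.adjoin_le_laurent (Algebra.subset_adjoin (Set.mem_range_self i)))
    refine h.isApprox_of_charZero ?_
    let _ := (IntermediateField.inclusion hle).toAlgebra
    have : IsScalarTower (IntermediateField.adjoin k (Set.range x)) h.closureField F :=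
      IsScalarTower.of_algebraMap_eq fun _ => rfl
    exact hy.tower_top h.closureField
  · exact h.isApprox_of_charP p hy

end IsMonomialSystem

/-- The field is algebraic over the field generated by the `x i`: these are algebraically
independent, and their number is the rational rank of `v`, that is, the transcendence degree. -/
lemma IsMonomial.isAlgebraic [v.RankOne] (hv : IsMonomial k v) (hx : FreelyGenerate v x) (y : F) :
    IsAlgebraic (generatedField k x) y := by
  have hindep := (hv.isMonomialSystem hx).algebraicIndependent
  obtain ⟨b, -⟩ := hx
  have htr : IsTranscendenceBasis k x := by
    refine hindep.isTranscendenceBasis_of_lift_trdeg_le_of_finite ?_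
    have h1 := hv.ratrank_eq_trdeg
    rw [ratrank, rank_eq_card_basis b, Cardinal.lift_natCast, eq_comm, Fintype.card_fin] at h1
    rw [Cardinal.mk_fin, Cardinal.lift_natCast]
    rw [Cardinal.lift_eq_nat_iff] at h1
    rw [h1, Cardinal.lift_natCast]
  exact htr.isAlgebraic_field.isAlgebraic y

variable (v x) in
/-- The valuation of `k(x₁, …, xₙ)` in additive notation. -/
def restrictLogValuation (k : Type*) [Field k] [Algebra k F] [v.RankOne] :
    AddValuation (generatedField k x) (WithTop ℝ) :=
  (logValuation v).comap (algebraMap (generatedField k x) F)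

variable (k x) in
/-- The elements `x i` of the field which they generate. -/
def generators (i : Fin n) : generatedField k x :=
  ⟨x i, IntermediateField.subset_adjoin k _ ⟨i, rfl⟩⟩

lemma mon_generators (I : Fin n → ℤ) : mon (generators k x) I = monomial k x I := rfl

lemma coe_monomial (I : Fin n → ℤ) : (monomial k x I : F) = mon x I := by
  rw [← mon_generators, mon, mon, ← IntermediateField.coe_val, map_prod]
  simp [generators]

lemma IsMonomialSystem.restrict [v.RankOne] {w : (Fin n → ℤ) →+ ℝ}
    (h : IsMonomialSystem k (logValuation v) x w) :
    IsMonomialSystem k (restrictLogValuation v x k) (generators k x) w where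
  triv := h.triv
  inj := h.inj
  val I := by
    rw [← h.val, ← coe_monomial (k := k) (x := x) I]
    rfl
  immediate y hy := by
    obtain ⟨a, I, ha⟩ := h.immediate (y : F) (by simpa using hy)
    refine ⟨a, I, ?_⟩
    rw [← coe_monomial (k := k) (x := x)] at ha
    exact ha

lemma coe_laurent_sum (L : (Fin n → ℤ) →₀ k) :
    ((∑ I ∈ L.support, algebraMap k (generatedField k x) (L I) *
      mon (generators k x) I : generatedField k x) : F) =
      ∑ I ∈ L.support, algebraMap k F (L I) * mon x I := by
  rw [← IntermediateField.coe_val, map_sum]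
  refine Finset.sum_congr rfl fun I _ => ?_
  rw [map_mul, ← coe_monomial (k := k) (x := x)]
  rfl

lemma IsMonomialSystem.IsApprox.restrict [v.RankOne] {y : generatedField k x}
    (hy : IsMonomialSystem.IsApprox k (logValuation v) x y) :
    IsMonomialSystem.IsApprox k (restrictLogValuation v x k) (generators k x) y := fun c => by
  obtain ⟨l, hl, hyl⟩ := hy c
  obtain ⟨L, rfl⟩ := IsMonomialSystem.mem_laurent_iff.1 hl
  refine ⟨∑ I ∈ L.support, algebraMap k _ (L I) * mon (generators k x) I,
    IsMonomialSystem.mem_laurent_iff.2 ⟨L, rfl⟩, ?_⟩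
  rw [← coe_laurent_sum] at hyl
  exact hyl

end Monomial

/-! ### Comparison of the completions -/

section Completions

variable {k F : Type*} [Field k] [Field F] [Algebra k F] {Γ₀ : Type*}
  [LinearOrderedCommGroupWithZero Γ₀] {v : Valuation F Γ₀} {n : ℕ} {x : Fin n → F}

lemma FreelyGenerate.weightHom_ne_zero [hr : v.RankOne] (hv : IsMonomial k v)
    (hx : FreelyGenerate v x) : weightHom (fun i => realValue v (x i)) ≠ 0 := by
  intro hw
  obtain ⟨y, hy0, hy1⟩ := Valuation.RankOne.nontrivial v
  obtain ⟨I, hI⟩ := hx.exists_eq (v.ne_zero_iff.1 hy0)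
  have hI0 : I = 0 := (hv.isMonomialSystem hx).inj (by simp [hw])
  rw [hI0, IsMonomialSystem.mon_zero, map_one] at hI
  exact hy1 hI.symm

/-- The isomorphism of completions obtained by identifying both with the ring of formal sums. -/
lemma exists_completion_equiv [v.RankOne]
    (h : IsMonomialSystem k (logValuation v) x (weightHom fun i => realValue v (x i)))
    (hdense : ∀ y, IsMonomialSystem.IsApprox k (logValuation v) x y)
    (φ : FormalSums k (fun i => realValue v (x i)) ≃+* v.Completion)
    (hφ : ∀ a, HasSum (term v x a.coeff) (φ a))
    (ψ : FormalSums k (fun i => realValue v (x i)) ≃+* (restrictToGenerated k v x).Completion)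
    (hψ : ∀ a, HasSum (term (restrictToGenerated k v x) (generators k x) a.coeff) (ψ a)) :
    ∃ e : (restrictToGenerated k v x).Completion ≃+* v.Completion,
      (∀ y : generatedField k x,
        e (toCompletionHom (restrictToGenerated k v x) y) = toCompletionHom v (y : F)) ∧
      ∀ z, Valued.v (e z) = Valued.v z := by
  have hval : ∀ a, Valued.v (φ a) = Valued.v (ψ a) := fun a => by
    by_cases ha : a = 0
    · simp [ha]
    · obtain ⟨I, hI, hmin⟩ := FormalSums.exists_min ha
      rw [valued_hasSum_term h (logValuation_le_iff v) (hφ a) hI hmin,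
        valued_hasSum_term h.restrict (fun y z => logValuation_le_iff v y z) (hψ a) hI hmin]
      exact congrArg v (coe_monomial I).symm
  have he : ∀ z, Valued.v ((ψ.symm.trans φ) z) = Valued.v z := fun z => by
    rw [RingEquiv.trans_apply, hval, ψ.apply_symm_apply]
  refine ⟨ψ.symm.trans φ, fun y => ?_, he⟩
  -- both sides agree on Laurent polynomials, hence differ by less than any value
  have hL : ∀ l ∈ IsMonomialSystem.laurent k (generators k x), (ψ.symm.trans φ)
      (toCompletionHom (restrictToGenerated k v x) l) = toCompletionHom v (l : F) := by
    intro l hl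
    obtain ⟨L, rfl⟩ := IsMonomialSystem.mem_laurent_iff.1 hl
    let a : FormalSums k (fun i => realValue v (x i)) :=
      FormalSums.mk (w := fun i => realValue v (x i)) L fun c =>
        L.support.finite_toSet.subset fun I hI => by
          simpa using Function.mem_support.1 hI.1
    have h1 := (hψ a).unique (hasSum_term_finsupp L)
    have h2 := (hφ a).unique (hasSum_term_finsupp L)
    rw [← h1, RingEquiv.trans_apply, ψ.symm_apply_apply, h2, coe_laurent_sum]
  by_contra hne
  rw [← sub_eq_zero] at hne
  obtain ⟨r, hr⟩ := exists_valued_eq v ((ψ.symm.trans φ)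
    (toCompletionHom (restrictToGenerated k v x) y) - toCompletionHom v (y : F))
  have hr0 : r ≠ 0 := by
    rintro rfl
    rw [map_zero, Valuation.zero_iff] at hr
    exact hne hr
  obtain ⟨c, hc⟩ := WithTop.ne_top_iff_exists.1 ((logValuation v).ne_top_iff.2 hr0)
  obtain ⟨l, hl, hyl⟩ := (hdense (y : F)).restrict (c + 1)
  have hlt : v ((y - l : generatedField k x) : F) < v r := by
    rw [logValuation_lt_iff, ← hc]
    refine lt_of_lt_of_le ?_ hyl
    rw [WithTop.coe_lt_coe]
    exact lt_add_one c
  refine absurd hr (ne_of_lt ?_)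
  have e1 : (ψ.symm.trans φ) (toCompletionHom (restrictToGenerated k v x) y) -
      toCompletionHom v (y : F) =
      (ψ.symm.trans φ) (toCompletionHom (restrictToGenerated k v x) (y - l)) -
        toCompletionHom v ((y - l : generatedField k x) : F) := by
    rw [map_sub, map_sub, hL l hl, AddSubgroupClass.coe_sub, map_sub, sub_sub_sub_cancel_right]
  rw [e1]
  refine Valuation.map_sub_lt _ ?_ ?_
  · rw [he, valued_toCompletionHom]
    exact hlt
  · rw [valued_toCompletionHom]
    exact hlt

end Completions

end MonomialValuation
end
open MonomialValuation in
theorem mainTheorem11 {k : Type*} {F : Type*} {Γ₀ : Type*} [Field k] [Field F] [Algebra k F]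
    [LinearOrderedCommGroupWithZero Γ₀]
    (hF : (⊤ : IntermediateField k F).FG)
    (v : Valuation F Γ₀) [v.RankOne] (hv : IsMonomial k v)
    {n : ℕ} (x : Fin n → F) (hx : FreelyGenerate v x) :
    ∃ (e : (restrictToGenerated k v x).Completion ≃+* v.Completion)
      (φ : FormalSums k (fun i => realValue v (x i)) ≃+* (restrictToGenerated k v x).Completion),
      -- `e` is an isomorphism of topological and valued fields extending `k(x₁, …, xₙ) ⊆ F`
      (∀ y : generatedField k x,
        e (toCompletion (restrictToGenerated k v x) y) = toCompletion v (y : F)) ∧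
      IsHomeomorph e ∧
      (∀ z, Valued.v (e z) = Valued.v z) ∧
      -- `φ` sends a formal sum `∑ a_I x^I` to the sum of this series in the completion
      (∀ a, HasSum
        (fun I : Fin n → ℤ => toCompletion (restrictToGenerated k v x)
          (algebraMap k (generatedField k x) (FormalSums.coeff a I) * monomial k x I)) (φ a)) ∧
      -- the valuation of `∑ a_I x^I` is the least of the valuations of its nonzero terms
      (∀ (a : FormalSums k (fun i => realValue v (x i))) (I : Fin n → ℤ), FormalSums.coeff a I ≠ 0 →
        (∀ J : Fin n → ℤ, FormalSums.coeff a J ≠ 0 →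
          realValue v (monomial k x I : F) ≤ realValue v (monomial k x J : F)) →
        Valued.v (φ a) = v (monomial k x I : F)) := by
  have h := hv.isMonomialSystem hx
  have hw := hx.weightHom_ne_zero hv
  have hdense : ∀ y, IsMonomialSystem.IsApprox k (logValuation v) x y :=
    fun y => h.isApprox_of_isAlgebraic (hv.isAlgebraic hx y)
  have hle : ∀ y z : generatedField k x, restrictToGenerated k v x y ≤
      restrictToGenerated k v x z ↔ restrictLogValuation v x k z ≤ restrictLogValuation v x k y :=
    fun y z => logValuation_le_iff v y z
  obtain ⟨φ, hφ⟩ := exists_formalSums_equiv h (logValuation_le_iff v) hw hdense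
  obtain ⟨ψ, hψ⟩ := exists_formalSums_equiv h.restrict hle hw fun y => (hdense y).restrict
  obtain ⟨e, he, hev⟩ := exists_completion_equiv h hdense φ hφ ψ hψ
  refine ⟨e, ψ, he, isHomeomorph_of_valued e hev, hev, hψ, fun a I hI hmin => ?_⟩
  refine valued_hasSum_term h.restrict hle (hψ a) hI fun J hJ => ?_
  have := hmin J hJ
  rwa [coe_monomial, coe_monomial, realValue_mon v hx.ne_zero, realValue_mon v hx.ne_zero] at this
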